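/- Let $N\ge 0$ and let $\pi\in S_{N+1}$. The involution $\pi\mapsto\bar\pi$ of $S_{N+1}$ is defined by $\bar\pi(1)=N+2-\pi(1)$ and $\bar\pi(i)=N+2-\pi(N+3-i)$ for $2\le i\le N+1$. A *weak excedance* of $\pi$ is an $i$ with $\pi(i)\ge i$; the other $i$ are *non-excedances*. Put $$\mathrm{wt}(\pi;q,\alpha,\beta)=q^{\mathrm{rk}(\pi)}\alpha^{-f(\pi)}\beta^{-u(\pi)},$$ where $\mathrm{rk}(\pi)$ is the number of pairs $(i,j)$ with $i<j\le\pi(i)<\pi(j)$ or $\pi(i)<\pi(j)<i<j$, $f(\pi)$ is the number of $i$ with $\pi(i)<\pi(1)$ and $\pi(i)<\pi(j)$ for all $j>i$, and $u(\pi)$ is the number of $i$ with $\pi(i)>\pi(1)$ and $\pi(i)>\pi(j)$ for all $j<i$. *The PT chain* with parameters $(q,\alpha,\beta)$ is the chain on $S_{N+1}$ with the transitions below. To *remove* a label $a$ from a permutation means to delete $a$ from its cycle (the preimage of $a$ is now sent to the image of $a$); to *insert a new label $x$ before $j$* means that the preimage of $j$ is now sent to $x$ and $x$ to $j$; after the operations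 the labels are replaced by $1,\dots,N+1$, preserving their order. Excedances refer to $\pi$, and $\pi$ goes * with probability $\frac{\alpha}{N+1}$, if $N\ge1$ and $\pi(2)=1$: to the permutation obtained by removing $2$ and adding a fixed point $i+\frac12$, where $i+1$ is the least non-excedance greater than $2$ ($i=N+1$ if there is none); * with probability $\frac{1}{N+1}$, for each $i$ with $2\le i\le N$, $\pi(i)\ge i$ and $\pi(i+1)<i+1$: if $\pi(i)=i$, to the permutation obtained by removing $i$ and adding a fixed point $j+\frac12$, where $j+1$ is the least non-excedance greater than $i+1$ ($j=N+1$ if there is none); if $\pi(i)>i$ and $\pi(i+1)<i$, to the permutation obtained by exchanging the values at $i$ and $i+1$; if $\pi(i)>i$ and $\pi(i+1)=i$, to the permutation obtained by removing $i+1$ and inserting a new label $j+\frac12$ before $j$, where $j$ is the greatest weak excedance less than $i$; * with probability $\frac{\beta}{N+1}$, if $N\ge1$ and $\pi(N+1)=N+1$: to the permutation obtained by removing $N+1$ and inserting a new label $j+\frac12$ before $j$, where $j$ is the greatest weak excedance less than $N+1$; * with probability $\frac{q}{N+1}$, for each $i\le N$ with $\pi(i)<i$ and $\pi(i+1)\ge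 i+1$: to the permutation obtained by exchanging the values at $i$ and $i+1$. All other transitions between distinct permutations have probability $0$, and the probability of staying at $\pi$ is $1$ minus the sum of the others. (For large parameters this number may be negative; in any case a *stationary distribution* is a probability vector $\mu$ with $\sum_\pi\mu(\pi)\,\mathrm{prob}(\pi\to\sigma)=\mu(\sigma)$ for all $\sigma$.) *Permutation tableaux.* For $\tau\in\{0,1\}^N$ let $\lambda(\tau)$ be the partition (rows of length $0$ are allowed) whose south-east border, from the north-east to the south-west corner, is the lattice path $p_1\cdots p_{N+1}$ with $p_1$ a step south, and $p_{i+1}$ a step south if $\tau_i=1$ and a step west if $\tau_i=0$. Let $\bar\tau=(1-\tau_N,\dots,1-\tau_1)$. A *permutation tableau* $\mathcal T$ of shape $\lambda$ is a filling of the boxes of the Young diagram of $\lambda$ with zeros and ones such that every column contains a $1$ and no $0$ has both a $1$ above it in its column and a $1$ to its left in its row. Let $\mathrm{rk}(\mathcal T)$ be the number of ones that have a $1$ above them in their column, $f(\mathcal T)$ the number of ones in the first row, and $u(\mathcal T)$ the number of rows not containing a $0$ with a $1$ above it, minus $1$. Put $F_\lambda(q,\alpha,\beta)=\sum_{\mathcal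 T}q^{\mathrm{rk}(\mathcal T)}\alpha^{-f(\mathcal T)}\beta^{-u(\mathcal T)}$, summed over all permutation tableaux of shape $\lambda$. **Claim.** 1. For every $\pi\in S_{N+1}$, $\mathrm{wt}(\pi;q,\alpha,\beta)=\mathrm{wt}(\bar\pi;q,\beta,\alpha)$, for all $q,\alpha,\beta$ in any field with $\alpha,\beta\ne0$. 2. For real $q\ge0$ and $\alpha,\beta>0$ the PT chain on $S_{N+1}$ has a unique stationary distribution, and for every $\pi\in S_{N+1}$ the stationary probability of $\pi$ in the PT chain with parameters $(q,\alpha,\beta)$ equals the stationary probability of $\bar\pi$ in the PT chain with parameters $(q,\beta,\alpha)$. 3. For every $\tau\in\{0,1\}^N$, $F_{\lambda(\tau)}(q,\alpha,\beta)=F_{\lambda(\bar\tau)}(q,\beta,\alpha)$, for all $q,\alpha,\beta$ in any field with $\alpha,\beta\ne0$. -/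

import Mathlib

/-! Positions and letters of a permutation of `{1, …, N+1}` are indexed from `0`, i.e. the element
`k : Fin (N + 1)` stands for the label `k + 1`.  Sites `1, …, N` are likewise `Fin N`. -/

namespace PTChain

/-! ### Statistics and weight of a permutation -/

/-- `i` is a weak excedance of `π`; otherwise it is a non-excedance. -/
abbrev WeakExc {n : ℕ} (π : Equiv.Perm (Fin n)) (i : Fin n) : Prop := i ≤ π i

/-- The number of crossings of `π`: pairs `i, j` with
`i < j ≤ π i < π j` or `π i < π j < i < j`. -/
def rk {n : ℕ} (π : Equiv.Perm (Fin n)) : ℕ :=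
  (Finset.univ.filter fun p : Fin n × Fin n =>
    (p.1 < p.2 ∧ p.2 ≤ π p.1 ∧ π p.1 < π p.2) ∨
    (π p.1 < π p.2 ∧ π p.2 < p.1 ∧ p.1 < p.2)).card

/-- The number of special RL-minima of `π`. -/
def f {N : ℕ} (π : Equiv.Perm (Fin (N + 1))) : ℕ :=
  (Finset.univ.filter fun i : Fin (N + 1) => (∀ j, i < j → π i < π j) ∧ π i < π 0).card

/-- The number of special LR-maxima of `π`. -/
def u {N : ℕ} (π : Equiv.Perm (Fin (N + 1))) : ℕ :=
  (Finset.univ.filter fun i : Fin (N + 1) => (∀ j, j < i → π j < π i) ∧ π 0 < π i).card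

/-- The weight `q ^ rk(π) * α ^ (-f(π)) * β ^ (-u(π))`. -/
def wt {K : Type*} [Field K] (q α β : K) {N : ℕ} (π : Equiv.Perm (Fin (N + 1))) : K :=
  q ^ rk π * α ^ (-(f π : ℤ)) * β ^ (-(u π : ℤ))

/-! ### The involution on permutations -/

/-- The involution `π ↦ π̄`, in one-based notation `π̄(1) = N + 2 - π(1)` and
`π̄(i) = N + 2 - π(N + 3 - i)` for `2 ≤ i ≤ N + 1`.  The position map `1 ↦ 1`, `i ↦ N + 3 - i` is,
zero-based, negation modulo `N + 1`; see `bar_zero` and `bar_pos`. -/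
def bar {N : ℕ} (π : Equiv.Perm (Fin (N + 1))) : Equiv.Perm (Fin (N + 1)) :=
  ((Equiv.neg (Fin (N + 1))).trans π).trans Fin.revPerm

theorem bar_zero {N : ℕ} (π : Equiv.Perm (Fin (N + 1))) :
    (bar π 0 : ℕ) = N - (π 0 : ℕ) := by
  simp [bar, Fin.val_rev]

theorem bar_pos {N : ℕ} (π : Equiv.Perm (Fin (N + 1))) (i j : Fin (N + 1))
    (hi : i ≠ 0) (hij : (i : ℕ) + j = N + 1) :
    (bar π i : ℕ) = N - (π j : ℕ) := by
  have h : -i = j := by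
    have hi' : 0 < (i : ℕ) := Nat.pos_of_ne_zero fun h => hi (Fin.ext h)
    have hlt := i.isLt
    apply Fin.ext
    rw [Fin.val_neg', Nat.mod_eq_of_lt (by omega)]
    omega
  simp [bar, h, Fin.val_rev]

/-! ### The PT chain on permutations -/

/-- The collapse of `π` at `a`: the letter `a` is cut out of its cycle, that is,
`π⁻¹ a` is now sent to `π a`.  The letter `a` is kept as a fixed point, to be placed elsewhere. -/
def collapseAt {n : ℕ} (π : Equiv.Perm (Fin n)) (a : Fin n) : Equiv.Perm (Fin n) :=
  Equiv.swap a (π a) * π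

/-- For a fixed point `a` of `π` and a letter `j ≠ a`: insert `a` in front of `j`, that is,
`π⁻¹ j` is now sent to `a`, and `a` is sent to `j`. -/
def insertBefore {n : ℕ} (π : Equiv.Perm (Fin n)) (a j : Fin n) : Equiv.Perm (Fin n) :=
  Equiv.swap a j * π

/-- The relabelling of the letters which moves `a` to `p` and is order preserving on the other
letters. -/
def relabel {N : ℕ} (a p : Fin (N + 1)) : Equiv.Perm (Fin (N + 1)) :=
  (finSuccEquiv' a).trans (finSuccEquiv' p).symm

/-- The normalization of `π` after the label `a` has been replaced by a (half-integral) label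
whose rank among all labels is `p`. -/
def normMove {N : ℕ} (π : Equiv.Perm (Fin (N + 1))) (a p : Fin (N + 1)) :
    Equiv.Perm (Fin (N + 1)) :=
  (relabel a p).permCongr π

/-- `p ≥ a` is the last position before the first non-excedance greater than `a`
(the last position overall, if there is no such non-excedance). -/
abbrev LastBeforeNonexc {n : ℕ} (π : Equiv.Perm (Fin n)) (a p : Fin n) : Prop :=
  a ≤ p ∧ (∀ k, a < k → k ≤ p → WeakExc π k) ∧
    ∀ k : Fin n, (k : ℕ) = p + 1 → ¬ WeakExc π k

/-- `j` is the greatest weak excedance less than `a`. -/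
abbrev PrevWeakExc {n : ℕ} (π : Equiv.Perm (Fin n)) (a j : Fin n) : Prop :=
  j < a ∧ WeakExc π j ∧ ∀ k, j < k → k < a → ¬ WeakExc π k

/-- "Particle enters from the left" (one-based: `π(2) = 1`): collapse `π` at the second letter `a`
and add a fixed point just before the next non-excedance, or at the very end if there is none. -/
abbrev EntersLeft {N : ℕ} (π σ : Equiv.Perm (Fin (N + 1))) : Prop :=
  ∃ a p : Fin (N + 1), (a : ℕ) = 1 ∧ π a = 0 ∧ LastBeforeNonexc π a p ∧
    σ = normMove (collapseAt π a) a p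

/-- "Particle hops right", case 1 (`i' = i + 1`): the fixed point `i` is removed, and a fixed point
is added just before the first non-excedance greater than `i'`, or at the very end if there is
none. -/
abbrev HopsRight₁ {N : ℕ} (π σ : Equiv.Perm (Fin (N + 1))) : Prop :=
  ∃ i i' p : Fin (N + 1), i ≠ 0 ∧ (i' : ℕ) = i + 1 ∧ π i = i ∧ π i' < i' ∧
    LastBeforeNonexc π i' p ∧ σ = normMove (collapseAt π i) i p

/-- "Particle hops right", case 2 (`i' = i + 1`): the values at `i` and `i'` are exchanged. -/
abbrev HopsRight₂ {N : ℕ} (π σ : Equiv.Perm (Fin (N + 1))) : Prop :=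
  ∃ i i' : Fin (N + 1), i ≠ 0 ∧ (i' : ℕ) = i + 1 ∧ i < π i ∧ π i' < i ∧
    σ = π * Equiv.swap i i'

/-- "Particle hops right", case 3 (`i' = i + 1`): `π` is collapsed at `i'`, and a new letter,
immediately following the greatest weak excedance `j` less than `i` in the order of the labels, is
inserted before `j` in its cycle. -/
abbrev HopsRight₃ {N : ℕ} (π σ : Equiv.Perm (Fin (N + 1))) : Prop :=
  ∃ i i' j p : Fin (N + 1), i ≠ 0 ∧ (i' : ℕ) = i + 1 ∧ i < π i ∧ π i' = i ∧
    PrevWeakExc π i j ∧ (p : ℕ) = j + 1 ∧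
    σ = normMove (insertBefore (collapseAt π i') i' j) i' p

/-- "Particle hops right". -/
abbrev HopsRight {N : ℕ} (π σ : Equiv.Perm (Fin (N + 1))) : Prop :=
  HopsRight₁ π σ ∨ HopsRight₂ π σ ∨ HopsRight₃ π σ

instance {N : ℕ} (π σ : Equiv.Perm (Fin (N + 1))) : Decidable (HopsRight π σ) :=
  have : Decidable (HopsRight₁ π σ) := inferInstance
  have : Decidable (HopsRight₂ π σ) := inferInstance
  have : Decidable (HopsRight₃ π σ) := inferInstance
  instDecidableOr

/-- "Particle exits to the right" (one-based: `π(N+1) = N+1`): the last letter is removed, and a new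
letter, immediately following the greatest weak excedance `j ≤ N` in the order of the labels,
is inserted before `j` in its cycle. -/
abbrev ExitsRight {N : ℕ} (π σ : Equiv.Perm (Fin (N + 1))) : Prop :=
  ∃ j p : Fin (N + 1), π (Fin.last N) = Fin.last N ∧ PrevWeakExc π (Fin.last N) j ∧
    (p : ℕ) = j + 1 ∧
    σ = normMove (insertBefore (collapseAt π (Fin.last N)) (Fin.last N) j) (Fin.last N) p

/-- "Particle hops left" (`i' = i + 1`): the values at `i` and `i'` are exchanged. -/
abbrev HopsLeft {N : ℕ} (π σ : Equiv.Perm (Fin (N + 1))) : Prop :=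
  ∃ i i' : Fin (N + 1), (i' : ℕ) = i + 1 ∧ π i < i ∧ i' ≤ π i' ∧ σ = π * Equiv.swap i i'

/-- The rate of the transition `π → σ` (`0` if there is none).  At most one of the four kinds
applies to a given pair `π, σ`. -/
noncomputable def rate (q α β : ℝ) {N : ℕ} (π σ : Equiv.Perm (Fin (N + 1))) : ℝ :=
  (if EntersLeft π σ then α else 0) + (if HopsRight π σ then 1 else 0) +
    (if ExitsRight π σ then β else 0) + (if HopsLeft π σ then q else 0)

/-- The transition probabilities of the PT chain on the permutations of `N + 1` letters. -/
noncomputable def prob (q α β : ℝ) {N : ℕ} (π σ : Equiv.Perm (Fin (N + 1))) : ℝ :=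
  if σ = π then 1 - ∑ ρ ∈ Finset.univ.erase π, rate q α β π ρ / (N + 1)
  else rate q α β π σ / (N + 1)

/-- `μ` is a stationary probability distribution (steady state) of the PT chain. -/
structure IsSteadyState (q α β : ℝ) {N : ℕ} (μ : Equiv.Perm (Fin (N + 1)) → ℝ) : Prop where
  nonneg : ∀ π, 0 ≤ μ π
  sum_eq_one : ∑ π, μ π = 1
  stationary : ∀ σ, ∑ π, μ π * prob q α β π σ = μ σ

/-! ### Permutation tableaux

A partition is given by the list of its row lengths (rows of length `0` are allowed).  Rows and
columns are numbered from `0`, from top to bottom and from left to right. -/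

/-- The partition cut out by a lattice path from the north-east to the south-west corner;
`true` is a step south, `false` a step west.  The row ending in a given step south has as many boxes
as there are steps west after it. -/
def pathPartition : List Bool → List ℕ
  | [] => []
  | true :: p => p.count false :: pathPartition p
  | false :: p => pathPartition p

/-- The partition `λ(τ)` of half-perimeter `N + 1` of a state `τ` of the PASEP with `N` sites
(`true` is a particle): the path starts with a step south, and its further steps are south at
particles and west at holes. -/
def shape {N : ℕ} (τ : Fin N → Bool) : List ℕ := pathPartition (true :: List.ofFn τ)

/-- The particle-hole symmetry `(τ₁, …, τ_N) ↦ (1 - τ_N, …, 1 - τ₁)`. -/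
def barState {N : ℕ} (τ : Fin N → Bool) : Fin N → Bool := fun i => !(τ i.rev)

/-- The boxes of the Young diagram of shape `l`: row `i` consists of the boxes `(i, j)`,
`j < l_i`. -/
def boxes (l : List ℕ) : Finset (ℕ × ℕ) :=
  (Finset.range l.length).biUnion fun i =>
    (Finset.range (l.getD i 0)).image fun j => (i, j)

/-- Some box above `c` in the same column contains a one.  Here and below, a filling of a Young
diagram with zeros and ones is given by the set `T` of the boxes that contain a one. -/
abbrev OneAbove (T : Finset (ℕ × ℕ)) (c : ℕ × ℕ) : Prop := ∃ i < c.1, (i, c.2) ∈ T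

/-- Some box to the left of `c` in the same row contains a one. -/
abbrev OneLeft (T : Finset (ℕ × ℕ)) (c : ℕ × ℕ) : Prop := ∃ j < c.2, (c.1, j) ∈ T

/-- `T` is (the set of ones of) a permutation tableau of shape `l`: every column contains a one,
and no zero has both a one above it and a one to its left. -/
abbrev IsPermTableau (l : List ℕ) (T : Finset (ℕ × ℕ)) : Prop :=
  T ⊆ boxes l ∧ (∀ j < l.headD 0, ∃ i < l.length, (i, j) ∈ T) ∧
    ∀ c ∈ boxes l, c ∉ T → ¬ (OneAbove T c ∧ OneLeft T c)

/-- All permutation tableaux of shape `l`. -/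
def permTableaux (l : List ℕ) : Finset (Finset (ℕ × ℕ)) :=
  (boxes l).powerset.filter fun T => IsPermTableau l T

/-- The rank of a tableau: the number of superfluous (that is, not topmost) ones. -/
def rkT (T : Finset (ℕ × ℕ)) : ℕ := (T.filter fun c => OneAbove T c).card

/-- The number of ones in the first row. -/
def fT (T : Finset (ℕ × ℕ)) : ℕ := (T.filter fun c => c.1 = 0).card

/-- The number of unrestricted rows (rows without a zero that has a one above it) minus `1`;
the first row is always unrestricted. -/
def uT (l : List ℕ) (T : Finset (ℕ × ℕ)) : ℕ :=
  ((Finset.range l.length).filter fun i =>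
    ¬ ∃ c ∈ boxes l, c.1 = i ∧ c ∉ T ∧ OneAbove T c).card - 1

/-- The weight generating function `F_λ` of the permutation tableaux of shape `l`. -/
def F {K : Type*} [Field K] (q α β : K) (l : List ℕ) : K :=
  ∑ T ∈ permTableaux l, q ^ rkT T * α ^ (-(fT T : ℤ)) * β ^ (-(uT l T : ℤ))

end PTChain

namespace PTChain

/-! The three symmetries have separate proofs: on weights, on the chain and on tableaux.

Weights: the involution keeps position `0`, reverses the remaining positions and reverses all
values. It exchanges `f` with `u`, and upper crossings not involving position `0` with lower
crossings; the crossings at position `0` are preserved in number by a double count. Hence `wt_bar`.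

Chain: it suffices that `wt` solves the balance equations and that their normalized solution is
unique; the symmetry of the weights then passes to the stationary distributions. For balance
(`sum_wt_mul_rate`), each permutation `ρ` of one letter less carries a cycle of states, obtained by
inserting one letter into `ρ` in all places allowed by `cycleState`. Entering, exiting and the first
and third forms of hopping right are exactly the steps of these cycles. By `wt_cycleState` the flux
along every step of the cycle of `ρ` is `wt ρ`, so each cycle brings as much into a state as it
takes out. The remaining transitions, the second form of hopping right and hopping left, are inverse
to each other; by `wt_mul_swap` the weights differ by a factor `q`, so they are in detailed balance.

Uniqueness (`eq_of_balance`) is a maximum principle. It needs a state reachable from everywhere: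
pushing the greatest positive weak excedance to the right and out leads to the only permutation
without positive weak excedances. No step with rate `q` is used, so `q = 0` is allowed.

Tableaux: no bijection with permutations is used. In terms of the lattice path, a leading hole
splits off `α⁻¹`, a trailing particle splits off `β⁻¹`, and `pathWeight_corner` resolves a particle
followed by a hole. Reversing and complementing the path while exchanging `α` and `β` permutes these
rules, and they determine the generating function (`pathWeight_reverse_map_not`). -/

/-! ### Statistics and weight under the involution -/

theorem bar_apply {N : ℕ} (π : Equiv.Perm (Fin (N + 1))) (i : Fin (N + 1)) :
    bar π i = (π (-i)).rev := rfl

theorem bar_bar {N : ℕ} (π : Equiv.Perm (Fin (N + 1))) : bar (bar π) = π := by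
  ext i
  simp [bar_apply]

theorem val_neg_of_ne_zero {N : ℕ} {i : Fin (N + 1)} (hi : i ≠ 0) :
    ((-i : Fin (N + 1)) : ℕ) = N + 1 - i := by
  have hi' : 0 < (i : ℕ) := Nat.pos_of_ne_zero fun h => hi (Fin.ext h)
  rw [Fin.val_neg', Nat.mod_eq_of_lt (by omega)]

/-- Both the nonzero positions and the values are reversed, so right-to-left minima become
left-to-right maxima. Position `0` is not reversed, but the comparison with it is exactly the
condition of being special. -/
theorem f_bar {N : ℕ} (π : Equiv.Perm (Fin (N + 1))) : f (bar π) = u π := by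
  unfold f u
  refine Finset.card_equiv (Equiv.neg _) fun i => ?_
  simp only [Finset.mem_filter, Finset.mem_univ, true_and, Equiv.neg_apply, bar_apply,
    Fin.rev_lt_rev, neg_zero]
  refine and_congr_left fun h0 => ?_
  have hi : i ≠ 0 := by rintro rfl; simp at h0
  have h1 := val_neg_of_ne_zero hi
  have hi0 : (i : ℕ) ≠ 0 := fun h => hi (Fin.ext h)
  constructor
  · intro h j hj
    by_cases hj0 : j = 0
    · subst hj0; exact h0
    · have h2 := val_neg_of_ne_zero hj0
      simpa using h (-j) (by rw [Fin.lt_def] at hj ⊢; omega)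
  · intro h j hj
    have hj0 : j ≠ 0 := by rintro rfl; simp at hj
    have h2 := val_neg_of_ne_zero hj0
    have := j.isLt
    exact h (-j) (by rw [Fin.lt_def] at hj ⊢; omega)

theorem u_bar {N : ℕ} (π : Equiv.Perm (Fin (N + 1))) : u (bar π) = f π := by
  rw [← f_bar, bar_bar]

/-- The crossings of `π` of the form `i < j ≤ π i < π j` with `i ≠ 0`. -/
def upperCrossings {N : ℕ} (π : Equiv.Perm (Fin (N + 1))) : Finset (Fin (N + 1) × Fin (N + 1)) :=
  Finset.univ.filter fun p => p.1 ≠ 0 ∧ p.1 < p.2 ∧ p.2 ≤ π p.1 ∧ π p.1 < π p.2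

/-- The crossings of `π` of the form `π i < π j < i < j`. -/
def lowerCrossings {N : ℕ} (π : Equiv.Perm (Fin (N + 1))) : Finset (Fin (N + 1) × Fin (N + 1)) :=
  Finset.univ.filter fun p => π p.1 < π p.2 ∧ π p.2 < p.1 ∧ p.1 < p.2

/-- The letters `j` such that `0 < j ≤ π 0 < π j`. -/
def firstCrossings {N : ℕ} (π : Equiv.Perm (Fin (N + 1))) : Finset (Fin (N + 1)) :=
  Finset.univ.filter fun j => j ≤ π 0 ∧ π 0 < π j

/-- Crossings at position `0` are split off because the involution fixes that position, so they do
not follow the exchange of upper and lower crossings. -/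
theorem rk_eq_add {N : ℕ} (π : Equiv.Perm (Fin (N + 1))) :
    rk π = (upperCrossings π).card + (lowerCrossings π).card + (firstCrossings π).card := by
  have h : (firstCrossings π).card = ((firstCrossings π).image fun j => ((0 : Fin (N + 1)), j)).card :=
    (Finset.card_image_of_injective _ fun a b h => by simpa using h).symm
  rw [h, ← Finset.card_union_of_disjoint, ← Finset.card_union_of_disjoint]
  · unfold rk
    congr 1
    ext ⟨i, j⟩
    simp only [upperCrossings, lowerCrossings, firstCrossings, Finset.mem_filter, Finset.mem_univ,
      true_and, Finset.mem_union, Finset.mem_image, Prod.mk.injEq]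
    constructor
    · rintro (h | h)
      · by_cases hi : i = 0
        · subst hi; exact Or.inr ⟨j, ⟨h.2.1, h.2.2⟩, rfl, rfl⟩
        · exact Or.inl (Or.inl ⟨hi, h⟩)
      · exact Or.inl (Or.inr h)
    · rintro ((h | h) | ⟨j, h, rfl, rfl⟩)
      · exact Or.inl h.2
      · exact Or.inr h
      · refine Or.inl ⟨?_, h⟩
        rcases Fin.eq_zero_or_eq_succ j with rfl | ⟨k, rfl⟩
        · exact absurd h.2 (lt_irrefl _)
        · exact Fin.succ_pos k
  · rw [Finset.disjoint_left]
    rintro ⟨i, j⟩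
    simp only [upperCrossings, lowerCrossings, Finset.mem_filter, Finset.mem_univ,
      true_and, Finset.mem_union, Finset.mem_image, Prod.mk.injEq]
    rintro (h | h) ⟨_, _, rfl, rfl⟩
    · exact h.1 rfl
    · exact absurd h.2.1 (by simp)
  · rw [Finset.disjoint_left]
    rintro ⟨i, j⟩
    simp only [upperCrossings, lowerCrossings, Finset.mem_filter, Finset.mem_univ, true_and]
    rintro h h'
    exact absurd (lt_trans h'.1 h'.2.1) (not_lt.2 (h.2.1.le.trans h.2.2.1))

theorem card_upperCrossings_bar {N : ℕ} (π : Equiv.Perm (Fin (N + 1))) :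
    (upperCrossings (bar π)).card = (lowerCrossings π).card := by
  refine Finset.card_nbij' (fun p => (-p.2, -p.1)) (fun p => (-p.2, -p.1)) ?_ ?_
    (fun p _ => by simp) (fun p _ => by simp)
  · rintro ⟨i, j⟩ h
    simp only [upperCrossings, lowerCrossings, Finset.coe_filter, Set.mem_ofPred_eq, Finset.mem_univ,
      true_and, bar_apply, Fin.rev_lt_rev] at h ⊢
    obtain ⟨hi, hij, h1, h2⟩ := h
    have hj : j ≠ 0 := by rintro rfl; simp at hij
    have e1 := val_neg_of_ne_zero hi
    have e2 := val_neg_of_ne_zero hj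
    have hi0 : (i : ℕ) ≠ 0 := fun h => hi (Fin.ext h)
    rw [Fin.le_def, Fin.val_rev] at h1
    refine ⟨h2, ?_, ?_⟩ <;> rw [Fin.lt_def] at * <;> omega
  · rintro ⟨i, j⟩ h
    simp only [upperCrossings, lowerCrossings, Finset.coe_filter, Set.mem_ofPred_eq, Finset.mem_univ,
      true_and, bar_apply, Fin.rev_lt_rev, neg_neg] at h ⊢
    obtain ⟨h1, h2, hij⟩ := h
    have hi : i ≠ 0 := by rintro rfl; simp at h2
    have hj : j ≠ 0 := by rintro rfl; simp at hij
    have e1 := val_neg_of_ne_zero hi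
    have e2 := val_neg_of_ne_zero hj
    have hi0 : (i : ℕ) ≠ 0 := fun h => hi (Fin.ext h)
    rw [Fin.lt_def] at h2 hij
    refine ⟨neg_ne_zero.2 hj, ?_, ?_, h1⟩
    · rw [Fin.lt_def]; omega
    · rw [Fin.le_def, Fin.val_rev]; omega

theorem card_lowerCrossings_bar {N : ℕ} (π : Equiv.Perm (Fin (N + 1))) :
    (lowerCrossings (bar π)).card = (upperCrossings π).card := by
  rw [← card_upperCrossings_bar, bar_bar]

/-- The involution turns the set of `j ≤ π 0` with `π j > π 0` into the set of `k > π 0` with `π k ≤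
π 0`. These are the two differences of the sets `{k | k ≤ π 0}` and `{k | π k ≤ π 0}`, which `π`
shows to be equinumerous. -/
theorem card_firstCrossings_bar {N : ℕ} (π : Equiv.Perm (Fin (N + 1))) :
    (firstCrossings (bar π)).card = (firstCrossings π).card := by
  have h1 : (firstCrossings (bar π)).card =
      (Finset.univ.filter fun k => π k ≤ π 0 ∧ ¬ k ≤ π 0).card := by
    refine Finset.card_equiv (Equiv.neg _) fun j => ?_
    simp only [firstCrossings, Finset.mem_filter, Finset.mem_univ, true_and, Equiv.neg_apply,
      bar_apply, Fin.rev_lt_rev, neg_zero, not_le]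
    by_cases hj : j = 0
    · subst hj; simp
    · have e := val_neg_of_ne_zero hj
      have hj0 : (j : ℕ) ≠ 0 := fun h => hj (Fin.ext h)
      have hne : π (-j) ≠ π 0 := fun h => hj (neg_eq_zero.1 (π.injective h))
      have hlt : π (-j) < π 0 ↔ π (-j) ≤ π 0 := ⟨le_of_lt, fun h => lt_of_le_of_ne h hne⟩
      rw [hlt, and_comm]
      refine and_congr_right fun _ => ?_
      rw [Fin.le_def, Fin.lt_def, Fin.val_rev]
      omega
  have h2 : (Finset.univ.filter fun k => π k ≤ π 0).card =
      (Finset.univ.filter fun k => k ≤ π 0).card :=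
    Finset.card_equiv π fun k => by simp
  rw [h1]
  have := Finset.card_sdiff_comm h2
  unfold firstCrossings
  convert this using 2
  · ext k; simp
  · ext k; simp

theorem rk_bar {N : ℕ} (π : Equiv.Perm (Fin (N + 1))) : rk (bar π) = rk π := by
  rw [rk_eq_add, rk_eq_add, card_upperCrossings_bar, card_lowerCrossings_bar,
    card_firstCrossings_bar, add_comm (lowerCrossings π).card]

theorem wt_bar {K : Type*} [Field K] (q α β : K) {N : ℕ} (π : Equiv.Perm (Fin (N + 1))) :
    wt q β α (bar π) = wt q α β π := by
  unfold wt
  rw [rk_bar, f_bar, u_bar, mul_right_comm]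

/-! ### Inserting a letter into a permutation -/

/-- The permutation obtained from `ρ` by inserting the position `p` with value `v`. -/
def ins {n : ℕ} (ρ : Equiv.Perm (Fin n)) (p v : Fin (n + 1)) : Equiv.Perm (Fin (n + 1)) :=
  (finSuccEquiv' p).trans ((Equiv.optionCongr ρ).trans (finSuccEquiv' v).symm)

@[simp] theorem ins_same {n : ℕ} (ρ : Equiv.Perm (Fin n)) (p v : Fin (n + 1)) :
    ins ρ p v p = v := by
  simp [ins]

@[simp] theorem ins_succAbove {n : ℕ} (ρ : Equiv.Perm (Fin n)) (p v : Fin (n + 1)) (x : Fin n) :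
    ins ρ p v (p.succAbove x) = v.succAbove (ρ x) := by
  simp [ins]

theorem ins_injective {n : ℕ} (p v : Fin (n + 1)) :
    Function.Injective fun ρ : Equiv.Perm (Fin n) => ins ρ p v := by
  intro ρ ρ' h
  ext x
  have := congrArg (fun σ => σ (p.succAbove x)) h
  simp only [ins_succAbove] at this
  rw [Fin.succAbove_right_injective this]

theorem exists_ins {n : ℕ} (π : Equiv.Perm (Fin (n + 1))) (p : Fin (n + 1)) :
    ∃ ρ, ins ρ p (π p) = π := by
  let e : Option (Fin n) ≃ Option (Fin n) :=
    (finSuccEquiv' p).symm.trans (π.trans (finSuccEquiv' (π p)))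
  have he : e none = none := by simp [e]
  refine ⟨Equiv.removeNone e, ?_⟩
  have h : Equiv.optionCongr (Equiv.removeNone e) = e := by
    ext1 x
    cases x with
    | none => simp [he]
    | some x =>
      rw [Equiv.optionCongr_apply, Option.map_some]
      refine Equiv.removeNone_some e ?_
      cases hx : e (some x) with
      | none => exact absurd (e.injective (hx.trans he.symm)) (by simp)
      | some y => exact ⟨y, rfl⟩
  unfold ins
  rw [h]
  ext x
  simp [e]

theorem val_succAbove {n : ℕ} (p : Fin (n + 1)) (x : Fin n) :
    (p.succAbove x : ℕ) = if (x : ℕ) < p then (x : ℕ) else x + 1 := by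
  simp only [Fin.succAbove, Fin.lt_def, Fin.val_castSucc]
  split_ifs <;> simp

theorem eq_ins_iff {n : ℕ} {σ : Equiv.Perm (Fin (n + 1))} {ρ : Equiv.Perm (Fin n)}
    {p v : Fin (n + 1)} :
    σ = ins ρ p v ↔ σ p = v ∧ ∀ x, σ (p.succAbove x) = v.succAbove (ρ x) := by
  constructor
  · rintro rfl
    simp
  · rintro ⟨h1, h2⟩
    refine Equiv.ext ((Fin.forall_iff_succAbove p).2 ⟨by simp [h1], fun x => by simp [h2]⟩)

/-- This duality reduces the insertion of a letter just after a weak excedance to the insertion of a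
fixed point, so only the latter needs a computation of weights. -/
theorem bar_ins {n : ℕ} (ρ : Equiv.Perm (Fin (n + 1))) (j : Fin (n + 1)) :
    bar (ins ρ j.succ j.castSucc) = ins (bar ρ) j.castSucc.rev j.castSucc.rev := by
  rw [eq_ins_iff]
  have hneg : -j.castSucc.rev = j.succ := by
    have h : j.castSucc.rev ≠ 0 := by
      intro h
      have := congrArg Fin.val h
      rw [Fin.val_rev] at this
      simp at this
      omega
    have := val_neg_of_ne_zero h
    apply Fin.ext
    rw [this, Fin.val_rev]
    simp
    omega
  have key : ∀ x, -(j.castSucc.rev.succAbove x) = j.succ.succAbove (-x) := by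
    intro x
    by_cases hx : x = 0
    · subst hx
      rw [Fin.succAbove_ne_zero_zero, neg_zero, neg_zero, Fin.succAbove_ne_zero_zero]
      · exact Fin.succ_ne_zero j
      · rintro h; rw [h] at hneg; simp at hneg; exact (Fin.succ_ne_zero j) hneg.symm
    · have h1 := val_neg_of_ne_zero hx
      have hx0 : (x : ℕ) ≠ 0 := fun h => hx (Fin.ext h)
      have h2 : j.castSucc.rev.succAbove x ≠ 0 := by
        intro h
        have := congrArg Fin.val h
        rw [val_succAbove] at this
        split_ifs at this <;> simp at this; omega
      have h3 := val_neg_of_ne_zero h2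
      apply Fin.ext
      rw [h3, val_succAbove, val_succAbove, h1, Fin.val_rev, Fin.val_succ, Fin.val_castSucc]
      split_ifs <;> omega
  constructor
  · rw [bar_apply, hneg, ins_same]
  · intro x
    rw [bar_apply, key, ins_succAbove, Fin.rev_succAbove, bar_apply]

/-! ### The statistics under insertion of a letter -/

theorem rk_eq_sum {n : ℕ} (π : Equiv.Perm (Fin n)) :
    rk π = ∑ i, ∑ j, if (i < j ∧ j ≤ π i ∧ π i < π j) ∨ (π i < π j ∧ π j < i ∧ i < j)
      then 1 else 0 := by
  rw [rk, Finset.card_filter, Fintype.sum_prod_type]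

/-- A fixed point takes part in no crossing, and the relabelling of the other letters is monotone on
positions and values alike. -/
theorem rk_ins {n : ℕ} (ρ : Equiv.Perm (Fin n)) (p : Fin (n + 1)) : rk (ins ρ p p) = rk ρ := by
  rw [rk_eq_sum, rk_eq_sum, Fin.sum_univ_succAbove _ p]
  have h0 : ∀ j, ¬ ((p < j ∧ j ≤ ins ρ p p p ∧ ins ρ p p p < ins ρ p p j) ∨
      (ins ρ p p p < ins ρ p p j ∧ ins ρ p p j < p ∧ p < j)) := by
    intro j
    rw [ins_same]
    rintro (h | h)
    · exact absurd h.1 (not_lt.2 h.2.1)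
    · exact absurd h.1 (not_lt.2 h.2.1.le)
  rw [Finset.sum_eq_zero fun j _ => if_neg (h0 j), zero_add]
  refine Finset.sum_congr rfl fun x _ => ?_
  rw [Fin.sum_univ_succAbove _ p, if_neg, zero_add]
  · refine Finset.sum_congr rfl fun y _ => ?_
    simp only [ins_succAbove, Fin.succAbove_lt_succAbove_iff, Fin.succAbove_le_succAbove_iff]
  · rw [ins_same]
    rintro (h | h)
    · exact absurd h.2.1 (not_le.2 h.2.2)
    · exact absurd h.2.1 (not_lt.2 h.2.2.le)

/-- Pigeonhole: the `x + 1` values at positions up to `x` are distinct. -/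
theorem lt_of_forall_le_val_lt {n : ℕ} (ρ : Equiv.Perm (Fin n)) (x : Fin n) (b : ℕ)
    (h : ∀ j ≤ x, (ρ j : ℕ) < b) : (x : ℕ) < b := by
  have : (Finset.Iic x).card ≤ (Finset.range b).card := by
    refine Finset.card_le_card_of_injOn (fun j => (ρ j : ℕ)) ?_ ?_
    · intro j hj
      simpa using h j (by simpa using hj)
    · intro a _ b _ hab
      exact ρ.injective (Fin.ext hab)
  simp at this
  omega

/-- If `p` is not last, the entry right after the new fixed point is smaller than `p`; this keeps
the new point from being a minimum and from spoiling an earlier one. If `p` is last, its value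
exceeds the first one, and every special minimum lies below it. -/
theorem f_ins {n : ℕ} (ρ : Equiv.Perm (Fin (n + 1))) (p : Fin (n + 2)) (hp : p ≠ 0)
    (h : ∀ k : Fin (n + 1), (k : ℕ) = p → ρ k < k) : f (ins ρ p p) = f ρ := by
  have hz : ins ρ p p 0 = p.succAbove (ρ 0) := by
    rw [← ins_succAbove ρ p, Fin.succAbove_ne_zero_zero hp]
  have hp' : (p : ℕ) ≠ 0 := fun h => hp (Fin.ext h)
  unfold f
  rw [Finset.card_filter, Finset.card_filter, Fin.sum_univ_succAbove _ p, if_neg, zero_add]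
  · refine Finset.sum_congr rfl fun x _ => ?_
    congr 1
    rw [Fin.forall_iff_succAbove p]
    simp only [ins_succAbove, ins_same, hz, Fin.succAbove_lt_succAbove_iff]
    rw [eq_iff_iff]
    refine and_congr_left fun hx0 => ⟨fun H => H.2, fun H => ⟨fun hx => ?_, H⟩⟩
    rw [Fin.lt_def, val_succAbove] at hx ⊢
    by_cases hk : (p : ℕ) < n + 1
    · have h1 := h ⟨p, hk⟩ rfl
      have h2 := H ⟨p, hk⟩ (by rw [Fin.lt_def]; simp only; split_ifs at hx <;> omega)
      rw [Fin.lt_def] at h1 h2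
      simp only at h1
      split_ifs <;> omega
    · have := p.isLt
      have := (ρ x).isLt
      rw [Fin.lt_def] at hx0
      split_ifs <;> omega
  · rw [ins_same, hz]
    rintro ⟨h1, h2⟩
    rw [Fin.lt_def, val_succAbove] at h2
    by_cases hk : (p : ℕ) < n + 1
    · have h3 := h ⟨p, hk⟩ rfl
      have h4 := h1 (p.succAbove ⟨p, hk⟩) (by rw [Fin.lt_def, val_succAbove]; simp)
      rw [ins_succAbove, Fin.lt_def, val_succAbove] at h4
      rw [Fin.lt_def] at h3
      simp only at h3
      split_ifs at h4 <;> omega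
    · have := p.isLt
      split_ifs at h2 <;> omega

/-- Before the last place the new fixed point is no maximum: otherwise positions `0, …, p` of `ρ`
would all have values below `p`. Later maxima are undisturbed, since a left-to-right maximum of `ρ`
is a weak excedance. In the last place the new point is a special maximum. -/
theorem u_ins {n : ℕ} (ρ : Equiv.Perm (Fin (n + 1))) (p : Fin (n + 2)) (hp : p ≠ 0)
    (h : ∀ k : Fin (n + 1), (k : ℕ) = p → ρ k < k) :
    u (ins ρ p p) = u ρ + if p = Fin.last _ then 1 else 0 := by
  have hz : ins ρ p p 0 = p.succAbove (ρ 0) := by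
    rw [← ins_succAbove ρ p, Fin.succAbove_ne_zero_zero hp]
  have hp' : (p : ℕ) ≠ 0 := fun h => hp (Fin.ext h)
  unfold u
  rw [Finset.card_filter, Finset.card_filter, Fin.sum_univ_succAbove _ p, add_comm]
  congr 1
  · refine Finset.sum_congr rfl fun x _ => ?_
    congr 1
    rw [Fin.forall_iff_succAbove p]
    simp only [ins_succAbove, ins_same, hz, Fin.succAbove_lt_succAbove_iff]
    rw [eq_iff_iff]
    refine and_congr_left fun hx0 => ⟨fun H => H.2, fun H => ⟨fun hx => ?_, H⟩⟩
    have hle : (x : ℕ) < ρ x + 1 := lt_of_forall_le_val_lt ρ x _ fun j hj => by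
      rcases hj.lt_or_eq with hj | rfl
      · exact (Fin.lt_def.1 (H j hj)).trans (Nat.lt_succ_self _)
      · exact Nat.lt_succ_self _
    rw [Fin.lt_def, val_succAbove] at hx ⊢
    split_ifs at hx ⊢ <;> omega
  · congr 1
    rw [ins_same, hz, eq_iff_iff]
    constructor
    · rintro ⟨h1, -⟩
      by_contra hne
      have hk : (p : ℕ) < n + 1 := by
        have := p.isLt
        by_contra hc
        exact hne (Fin.ext (by simp; omega))
      have h3 := h ⟨p, hk⟩ rfl
      refine absurd (lt_of_forall_le_val_lt ρ ⟨p, hk⟩ p fun j hj => ?_) (by simp)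
      rcases hj.lt_or_eq with hj | rfl
      · have h4 := h1 (p.succAbove j) (by
          rw [Fin.lt_def] at hj ⊢; rw [val_succAbove]; simp only at hj; split_ifs <;> omega)
        rw [ins_succAbove, Fin.lt_def, val_succAbove] at h4
        split_ifs at h4 <;> omega
      · exact h3
    · rintro rfl
      refine ⟨fun j hj => ?_, ?_⟩
      · obtain ⟨y, rfl⟩ := Fin.exists_succAbove_eq hj.ne
        rw [ins_succAbove, Fin.succAbove_last]
        exact Fin.castSucc_lt_last _
      · rw [Fin.succAbove_last]
        exact Fin.castSucc_lt_last _

/-- The weight of a permutation with a fixed point inserted before a non-excedance. -/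
theorem wt_ins_fixed {K : Type*} [Field K] (q α β : K) {n : ℕ} (ρ : Equiv.Perm (Fin (n + 1)))
    (hβ : β ≠ 0) (p : Fin (n + 2)) (hp : p ≠ 0) (h : ∀ k : Fin (n + 1), (k : ℕ) = p → ρ k < k) :
    wt q α β ρ = wt q α β (ins ρ p p) * if p = Fin.last _ then β else 1 := by
  unfold wt
  rw [rk_ins, f_ins ρ p hp h, u_ins ρ p hp h]
  split_ifs
  · rw [mul_assoc (q ^ rk ρ * _)]
    congr 1
    rw [← zpow_add_one₀ hβ]
    congr 1
    push_cast
    ring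
  · simp

/-- The weight of a permutation with a letter inserted after a weak excedance. -/
theorem wt_ins_descent {K : Type*} [Field K] (q α β : K) {n : ℕ} (ρ : Equiv.Perm (Fin (n + 1)))
    (hα : α ≠ 0) (j : Fin (n + 1)) (h : j ≤ ρ j) :
    wt q α β ρ = wt q α β (ins ρ j.succ j.castSucc) * if j = 0 then α else 1 := by
  -- After applying the involution a fixed point is inserted before a non-excedance, with `α` and
  -- `β` exchanged; its place is last exactly when `j = 0`.
  rw [← wt_bar q α β ρ, ← wt_bar q α β (ins _ _ _), bar_ins]
  rw [wt_ins_fixed q β α (bar ρ) hα j.castSucc.rev]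
  · congr 2
    rw [eq_iff_iff]
    constructor
    · intro h
      have := congrArg Fin.val h
      rw [Fin.val_rev, Fin.val_last, Fin.val_castSucc] at this
      exact Fin.ext (by rw [Fin.val_zero]; omega)
    · rintro rfl
      simp
  · intro h
    have := congrArg Fin.val h
    rw [Fin.val_rev] at this
    simp at this
    omega
  · intro k hk
    rw [Fin.val_rev, Fin.val_castSucc] at hk
    have hk0 : k ≠ 0 := by rintro rfl; rw [Fin.val_zero] at hk; have := j.isLt; omega
    have h1 := val_neg_of_ne_zero hk0
    have h2 : -k = j := Fin.ext (by omega)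
    rw [bar_apply, h2, Fin.lt_def, Fin.val_rev]
    rw [Fin.le_def] at h
    omega

/-! ### Exchanging the values at two adjacent positions -/

theorem swap_lt_swap_iff {n : ℕ} {i i' x y : Fin n} (hi : (i' : ℕ) = i + 1)
    (h1 : ¬ (x = i ∧ y = i')) (h2 : ¬ (x = i' ∧ y = i)) :
    Equiv.swap i i' x < Equiv.swap i i' y ↔ x < y := by
  have hc : ∀ z, (Equiv.swap i i' z : ℕ) =
      if (z : ℕ) = i then (i' : ℕ) else if (z : ℕ) = i' then (i : ℕ) else z := by
    intro z
    rw [Equiv.swap_apply_def]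
    simp only [Fin.ext_iff]
    split_ifs <;> rfl
  simp only [Fin.lt_def, hc, Fin.ext_iff] at *
  split_ifs <;> omega

/-- The special minima correspond under the exchange of `i` and `i'`. The only comparison that
changes is the one between these two positions, and the larger value, `π i`, belongs to a special
minimum neither before nor after the exchange. -/
theorem f_mul_swap {N : ℕ} (π : Equiv.Perm (Fin (N + 1))) (i i' : Fin (N + 1))
    (hi : (i' : ℕ) = i + 1) (h1 : i < π i) (h2 : π i' < i) : f (π * Equiv.swap i i') = f π := by
  have hlt : i < i' := by rw [Fin.lt_def]; omega
  have h0 : i ≠ 0 := by rintro rfl; simp at h2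
  have h0' : i' ≠ 0 := by rintro rfl; simp at hi
  have hz : (π * Equiv.swap i i') 0 = π 0 := by
    rw [Equiv.Perm.mul_apply, Equiv.swap_apply_of_ne_of_ne h0.symm h0'.symm]
  symm
  refine Finset.card_equiv (Equiv.swap i i') fun x => ?_
  simp only [Finset.mem_filter, Finset.mem_univ, true_and, hz]
  rw [← (Equiv.swap i i').forall_congr_right (q := fun j => Equiv.swap i i' x < j →
    (π * Equiv.swap i i') (Equiv.swap i i' x) < (π * Equiv.swap i i') j)]
  simp only [Equiv.Perm.mul_apply, Equiv.swap_apply_self]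
  by_cases hx : x = i
  · subst hx
    rw [Equiv.swap_apply_left]
    constructor
    · rintro ⟨h, -⟩
      exact absurd (h i' hlt) (not_lt.2 (h2.trans h1).le)
    · rintro ⟨h, h3⟩
      exfalso
      -- Otherwise all positions from `i'` on, and also position `0`, would have values at least
      -- `i'`: one value too many.
      have hc : (insert 0 (Finset.Ici i')).card ≤ (Finset.Ici i').card := by
        refine Finset.card_le_card_of_injOn ((π * Equiv.swap x i' : Equiv.Perm _)) ?_ (π * Equiv.swap x i').injective.injOn
        intro y hy
        simp only [Finset.coe_insert, Finset.coe_Ici, Set.mem_insert_iff, Set.mem_Ici] at hy ⊢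
        rw [Fin.lt_def] at h1
        rcases hy with rfl | hy
        · rw [hz, Fin.le_def]; rw [Fin.lt_def] at h3; omega
        · rw [Equiv.Perm.mul_apply]
          rcases hy.lt_or_eq with hy | rfl
          · have h4 := h y (by rwa [Equiv.swap_apply_of_ne_of_ne (hlt.trans hy).ne' hy.ne'])
            rw [Equiv.swap_apply_of_ne_of_ne (hlt.trans hy).ne' hy.ne', Fin.le_def]
            rw [Fin.lt_def] at h4; omega
          · rw [Equiv.swap_apply_right, Fin.le_def]; omega
      rw [Finset.card_insert_of_notMem (by simpa using h0')] at hc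
      omega
  · refine and_congr_left fun _ => forall_congr' fun y => ?_
    by_cases hy : x = i' ∧ y = i
    · obtain ⟨rfl, rfl⟩ := hy
      simp [hlt, h2.trans h1]
    · rw [swap_lt_swap_iff hi (fun h => hx h.1) hy]

theorem bar_mul_swap {N : ℕ} (π : Equiv.Perm (Fin (N + 1))) (i i' : Fin (N + 1)) :
    bar (π * Equiv.swap i i') = bar π * Equiv.swap (-i') (-i) := by
  ext x
  have : Equiv.swap i i' (-x) = - Equiv.swap (-i') (-i) x := by
    rw [Equiv.swap_apply_def, Equiv.swap_apply_def]
    simp only [neg_eq_iff_eq_neg (a := x)]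
    split_ifs with h1 h2 h2 <;> simp_all
  rw [bar_apply, Equiv.Perm.mul_apply, this, Equiv.Perm.mul_apply, bar_apply]

theorem u_mul_swap {N : ℕ} (π : Equiv.Perm (Fin (N + 1))) (i i' : Fin (N + 1))
    (hi : (i' : ℕ) = i + 1) (h1 : i < π i) (h2 : π i' < i) : u (π * Equiv.swap i i') = u π := by
  have h0 : i ≠ 0 := by rintro rfl; simp at h2
  have h0' : i' ≠ 0 := by rintro rfl; simp at hi
  have e := val_neg_of_ne_zero h0
  have e' := val_neg_of_ne_zero h0'
  have := i'.isLt
  rw [Fin.lt_def] at h1 h2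
  rw [← f_bar, bar_mul_swap, f_mul_swap, f_bar]
  · omega
  · rw [bar_apply, neg_neg, Fin.lt_def, Fin.val_rev]; omega
  · rw [bar_apply, neg_neg, Fin.lt_def, Fin.val_rev]; omega

theorem rk_mul_swap {N : ℕ} (π : Equiv.Perm (Fin (N + 1))) (i i' : Fin (N + 1))
    (hi : (i' : ℕ) = i + 1) (h1 : i < π i) (h2 : π i' < i) :
    rk π = rk (π * Equiv.swap i i') + 1 := by
  obtain ⟨z, hz⟩ := π.surjective i
  have hzi : z ≠ i := by rintro rfl; exact h1.ne' hz
  have hzi' : z ≠ i' := by rintro rfl; exact h2.ne hz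
  -- The crossing that is lost involves the preimage `z` of `i`: it is the upper crossing `z < i ≤ i
  -- < π i` or the lower crossing `π i' < i < i' < z`, depending on the side of `i` on which `z`
  -- lies.
  let c : Fin (N + 1) × Fin (N + 1) := if z < i then (z, i) else (i', z)
  have hA : ∀ x, ((π x : ℕ) = i → (x : ℕ) = z) ∧ ((x : ℕ) = z → (π x : ℕ) = i) :=
    fun x => ⟨fun h => congrArg Fin.val (π.injective ((Fin.ext h).trans hz.symm)),
      fun h => by rw [Fin.ext h, hz]⟩
  have hB : ∀ x : Fin (N + 1), (x : ℕ) = i → (π x : ℕ) = π i := fun x h => by rw [Fin.ext h]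
  have hC : ∀ x : Fin (N + 1), (x : ℕ) = i + 1 → (π x : ℕ) = π i' := fun x h => by
    rw [Fin.ext (h.trans hi.symm)]
  have hs : ∀ x, (Equiv.swap i i' x : ℕ) =
      if (x : ℕ) = i then (i : ℕ) + 1 else if (x : ℕ) = i + 1 then (i : ℕ) else x := by
    intro x
    rw [Equiv.swap_apply_def]
    simp only [Fin.ext_iff, hi]
    split_ifs <;> simp_all
  -- Reindexing by the transposition keeps the values `π` and moves the change into the positions,
  -- so that both sets of pairs can be compared elementwise.
  have hr : rk (π * Equiv.swap i i') = (Finset.univ.filter fun p : Fin (N + 1) × Fin (N + 1) =>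
      (Equiv.swap i i' p.1 < Equiv.swap i i' p.2 ∧ Equiv.swap i i' p.2 ≤ π p.1 ∧ π p.1 < π p.2) ∨
      (π p.1 < π p.2 ∧ π p.2 < Equiv.swap i i' p.1 ∧
        Equiv.swap i i' p.1 < Equiv.swap i i' p.2)).card := by
    unfold rk
    refine Finset.card_equiv ((Equiv.swap i i').prodCongr (Equiv.swap i i')) fun p => ?_
    rw [Finset.mem_filter, Finset.mem_filter]
    simp
  rw [Fin.lt_def] at h1 h2
  rw [Ne, Fin.ext_iff] at hzi hzi'
  rw [hr, rk, ← Finset.card_insert_of_notMem (a := c)]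
  · congr 1
    ext ⟨x, y⟩
    have hx := hA x
    have hy := hA y
    have hx1 := hB x
    have hy1 := hB y
    have hx2 := hC x
    have hy2 := hC y
    have hxy : (x : ℕ) = y → (π x : ℕ) = π y := fun h => by rw [Fin.ext h]
    simp only [Finset.mem_insert, Finset.mem_filter, Finset.mem_univ, true_and, Fin.lt_def,
      Fin.le_def, hs, c]
    split_ifs <;> simp only [Prod.mk.injEq, Fin.ext_iff] <;> omega
  · have hx := hA z
    by_cases hc : z < i
    · simp only [Finset.mem_filter, Finset.mem_univ, true_and, Fin.lt_def, Fin.le_def, hs, c,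
        if_pos hc]
      rw [Fin.lt_def] at hc
      split_ifs <;> omega
    · simp only [Finset.mem_filter, Finset.mem_univ, true_and, Fin.lt_def, Fin.le_def, hs, c,
        if_neg hc]
      rw [Fin.lt_def] at hc
      split_ifs <;> omega

/-- Exchanging the values at `i` and `i + 1` removes exactly one crossing. -/
theorem wt_mul_swap {K : Type*} [Field K] (q α β : K) {N : ℕ} (π : Equiv.Perm (Fin (N + 1)))
    (i i' : Fin (N + 1)) (hi : (i' : ℕ) = i + 1) (h1 : i < π i) (h2 : π i' < i) :
    wt q α β π = q * wt q α β (π * Equiv.swap i i') := by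
  unfold wt
  rw [f_mul_swap π i i' hi h1 h2, u_mul_swap π i i' hi h1 h2, rk_mul_swap π i i' hi h1 h2]
  ring

/-! ### Weak excedances as a predicate on natural numbers -/

/-- `k` is (the value of) a weak excedance of `π`. -/
def wexc {n : ℕ} (π : Equiv.Perm (Fin n)) (k : ℕ) : Prop := ∃ h : k < n, k ≤ (π ⟨k, h⟩ : ℕ)

theorem wexc_val {n : ℕ} (π : Equiv.Perm (Fin n)) (i : Fin n) : wexc π i ↔ i ≤ π i :=
  ⟨fun h => h.2, fun h => ⟨i.2, h⟩⟩

theorem wexc.lt {n : ℕ} {π : Equiv.Perm (Fin n)} {k : ℕ} (h : wexc π k) : k < n := h.1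

theorem wexc_zero {n : ℕ} (π : Equiv.Perm (Fin (n + 1))) : wexc π 0 := ⟨n.succ_pos, Nat.zero_le _⟩

theorem lastBeforeNonexc_iff {n : ℕ} (π : Equiv.Perm (Fin n)) (a p : Fin n) :
    LastBeforeNonexc π a p ↔
      (a : ℕ) ≤ p ∧ (∀ k : ℕ, (a : ℕ) < k → k ≤ p → wexc π k) ∧ ¬ wexc π (p + 1) := by
  refine and_congr Iff.rfl (and_congr ⟨fun h k h1 h2 => ?_, fun h k h1 h2 => ?_⟩
    ⟨fun h hw => ?_, fun h k hk hw => ?_⟩)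
  · exact ⟨h2.trans_lt p.2, h ⟨k, h2.trans_lt p.2⟩ h1 h2⟩
  · exact (wexc_val π k).1 (h k h1 h2)
  · exact h ⟨p + 1, hw.1⟩ rfl hw.2
  · exact h (hk ▸ (wexc_val π k).2 hw)

theorem prevWeakExc_iff {n : ℕ} (π : Equiv.Perm (Fin n)) (a j : Fin n) :
    PrevWeakExc π a j ↔
      (j : ℕ) < a ∧ wexc π j ∧ ∀ k : ℕ, (j : ℕ) < k → k < a → ¬ wexc π k := by
  refine and_congr Iff.rfl (and_congr (wexc_val π j).symm
    ⟨fun h k h1 h2 hw => ?_, fun h k h1 h2 hw => ?_⟩)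
  · exact h ⟨k, hw.1⟩ h1 h2 hw.2
  · exact h k h1 h2 ((wexc_val π k).2 hw)

theorem wexc_ins_fixed {n : ℕ} (ρ : Equiv.Perm (Fin n)) (p : Fin (n + 1)) (k : ℕ) :
    wexc (ins ρ p p) k ↔ (k < p ∧ wexc ρ k) ∨ k = p ∨ ((p : ℕ) < k ∧ wexc ρ (k - 1)) := by
  by_cases hk : k < n + 1
  · obtain ⟨i, rfl⟩ : ∃ i : Fin (n + 1), (i : ℕ) = k := ⟨⟨k, hk⟩, rfl⟩
    rw [wexc_val]
    by_cases hi : i = p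
    · subst hi; simp
    · obtain ⟨x, rfl⟩ := Fin.exists_succAbove_eq hi
      rw [ins_succAbove, Fin.succAbove_le_succAbove_iff, ← wexc_val, val_succAbove]
      split_ifs with h
      · simp [h, h.not_gt, h.ne]
      · simp [Nat.lt_succ_of_le (not_lt.1 h), (Nat.lt_succ_of_le (not_lt.1 h)).not_gt,
          (Nat.lt_succ_of_le (not_lt.1 h)).ne']
  · have := p.isLt
    refine iff_of_false (fun h => hk h.1) ?_
    rintro (h | h | h)
    · omega
    · omega
    · have := h.2.1; omega

theorem wexc_ins_descent {n : ℕ} (ρ : Equiv.Perm (Fin n)) (j : Fin n) (k : ℕ) :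
    wexc (ins ρ j.succ j.castSucc) k ↔
      (k < j + 1 ∧ wexc ρ k) ∨ ((j : ℕ) + 1 < k ∧ wexc ρ (k - 1)) := by
  by_cases hk : k < n + 1
  · obtain ⟨i, rfl⟩ : ∃ i : Fin (n + 1), (i : ℕ) = k := ⟨⟨k, hk⟩, rfl⟩
    rw [wexc_val]
    by_cases hi : i = j.succ
    · subst hi; simp
    · obtain ⟨x, rfl⟩ := Fin.exists_succAbove_eq hi
      rw [ins_succAbove, Fin.le_def, val_succAbove, val_succAbove, Fin.val_succ, Fin.val_castSucc]
      have h := wexc_val ρ x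
      rw [Fin.le_def] at h
      split_ifs with h1 h2 h2
      · rw [h]; omega
      · rw [h]; omega
      · rw [Nat.add_sub_cancel, h]; omega
      · rw [Nat.add_sub_cancel, h]; omega
  · have := j.isLt
    refine iff_of_false (fun h => hk h.1) ?_
    rintro (h | h)
    · omega
    · have := h.2.1; omega

/-! ### Moving an inserted letter -/

theorem relabel_succAbove {N : ℕ} (a p : Fin (N + 1)) (x : Fin N) :
    relabel a p (a.succAbove x) = p.succAbove x := by
  simp [relabel]

theorem relabel_same {N : ℕ} (a p : Fin (N + 1)) : relabel a p a = p := by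
  simp [relabel]

theorem normMove_ins {N : ℕ} (ρ : Equiv.Perm (Fin N)) (a p : Fin (N + 1)) :
    normMove (ins ρ a a) a p = ins ρ p p := by
  rw [eq_ins_iff]
  have h1 : (relabel a p).symm p = a := by rw [Equiv.symm_apply_eq, relabel_same]
  have h2 : ∀ x, (relabel a p).symm (p.succAbove x) = a.succAbove x := fun x => by
    rw [Equiv.symm_apply_eq, relabel_succAbove]
  refine ⟨?_, fun x => ?_⟩
  · rw [normMove, Equiv.permCongr_apply, h1, ins_same, relabel_same]
  · rw [normMove, Equiv.permCongr_apply, h2, ins_succAbove, relabel_succAbove]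

theorem collapseAt_ins_fixed {N : ℕ} (ρ : Equiv.Perm (Fin N)) (a : Fin (N + 1)) :
    collapseAt (ins ρ a a) a = ins ρ a a := by
  rw [collapseAt, ins_same, Equiv.swap_self]
  rfl

theorem swap_mul_ins {N : ℕ} (ρ : Equiv.Perm (Fin N)) (j : Fin N) :
    Equiv.swap j.succ j.castSucc * ins ρ j.succ j.castSucc = ins ρ j.succ j.succ := by
  rw [eq_ins_iff]
  refine ⟨by simp, fun x => ?_⟩
  rw [Equiv.Perm.mul_apply, ins_succAbove]
  by_cases hx : ρ x = j
  · rw [hx]; simp [Fin.succAbove_castSucc_self, Fin.succAbove_succ_self]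
  · have hx' : (ρ x : ℕ) ≠ j := fun h => hx (Fin.ext h)
    rw [Equiv.swap_apply_of_ne_of_ne]
    · apply Fin.ext
      simp only [val_succAbove, Fin.val_succ, Fin.val_castSucc]
      split_ifs <;> omega
    · intro h
      have := congrArg Fin.val h
      simp only [val_succAbove, Fin.val_succ, Fin.val_castSucc] at this
      split_ifs at this <;> omega
    · exact Fin.succAbove_ne _ _

theorem collapseAt_ins_descent {N : ℕ} (ρ : Equiv.Perm (Fin N)) (j : Fin N) :
    collapseAt (ins ρ j.succ j.castSucc) j.succ = ins ρ j.succ j.succ := by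
  rw [collapseAt, ins_same, swap_mul_ins]

theorem normMove_insertBefore {N : ℕ} (ρ : Equiv.Perm (Fin N)) (a : Fin (N + 1)) (j : Fin N)
    (hj : j.castSucc < a) :
    normMove (insertBefore (ins ρ a a) a j.castSucc) a j.succ = ins ρ j.succ j.castSucc := by
  have h1 : relabel a j.succ j.castSucc = j.castSucc := by
    have h := relabel_succAbove a j.succ j
    rwa [Fin.succAbove_of_castSucc_lt _ _ hj, Fin.succAbove_succ_self] at h
  have h2 : normMove (insertBefore (ins ρ a a) a j.castSucc) a j.succ =
      Equiv.swap j.succ j.castSucc * normMove (ins ρ a a) a j.succ := by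
    ext x
    simp only [normMove, insertBefore, Equiv.permCongr_apply, Equiv.Perm.mul_apply]
    rw [(relabel a j.succ).injective.map_swap, relabel_same, h1]
  rw [h2, normMove_ins, ← swap_mul_ins, ← mul_assoc, Equiv.swap_mul_self, one_mul]

/-! ### The cyclic order on the letters of a permutation -/

/-- The cyclic order `m ↦ m'` on `{0, …, n}` in which the elements satisfying `w` come first, in
decreasing order, and then the other elements, in increasing order. -/
def CyclicNext {n : ℕ} (w : ℕ → Prop) (m m' : Fin (n + 1)) : Prop :=
  ((m = 0 ∨ (¬ w m ∧ m ≠ Fin.last n)) ∧ m < m' ∧ ¬ w m' ∧ ∀ k, (m : ℕ) < k → k < m' → w k) ∨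
    ((m = Fin.last n ∨ (w m ∧ m ≠ 0)) ∧ m' < m ∧ w m' ∧ ∀ k, (m' : ℕ) < k → k < m → ¬ w k)

theorem exists_cyclicNext {n : ℕ} {w : ℕ → Prop} (h0 : w 0) (hn : ¬ w (n + 1))
    (m : Fin (n + 2)) : ∃ m', CyclicNext w m m' := by
  classical
  by_cases hm : m = 0 ∨ (¬ w m ∧ m ≠ Fin.last (n + 1))
  · have hne : (Finset.univ.filter fun k : Fin (n + 2) => m < k ∧ ¬ w k).Nonempty := by
      refine ⟨Fin.last (n + 1), ?_⟩
      simp only [Finset.mem_filter, Finset.mem_univ, true_and]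
      refine ⟨?_, by simpa using hn⟩
      rcases hm with rfl | hm
      · exact Fin.last_pos
      · exact Fin.lt_last_iff_ne_last.2 hm.2
    obtain ⟨m', h1, h2⟩ := Finset.exists_min_image _ id hne
    simp only [Finset.mem_filter, Finset.mem_univ, true_and, id] at h1 h2
    refine ⟨m', Or.inl ⟨hm, h1.1, h1.2, fun k hk hk' => ?_⟩⟩
    by_contra hw
    exact absurd (h2 ⟨k, hk'.trans m'.2⟩ ⟨hk, hw⟩) (not_le.2 hk')
  · have hm' : m = Fin.last (n + 1) ∨ (w m ∧ m ≠ 0) := by tauto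
    have hne : (Finset.univ.filter fun k : Fin (n + 2) => k < m ∧ w k).Nonempty := by
      refine ⟨0, ?_⟩
      simp only [Finset.mem_filter, Finset.mem_univ, true_and]
      exact ⟨Fin.pos_iff_ne_zero.2 fun h => hm (Or.inl h), by simpa using h0⟩
    obtain ⟨m', h1, h2⟩ := Finset.exists_max_image _ id hne
    simp only [Finset.mem_filter, Finset.mem_univ, true_and, id] at h1 h2
    refine ⟨m', Or.inr ⟨hm', h1.1, h1.2, fun k hk hk' hw => ?_⟩⟩
    exact absurd (h2 ⟨k, hk'.trans m.2⟩ ⟨hk', hw⟩) (not_le.2 hk)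

theorem CyclicNext.left_unique {n : ℕ} {w : ℕ → Prop} {a b m : Fin (n + 1)}
    (ha : CyclicNext w a m) (hb : CyclicNext w b m) : a = b := by
  simp only [CyclicNext, Fin.ext_iff, Fin.lt_def, Fin.val_zero, Fin.val_last] at *
  by_contra hab
  rcases ha with ⟨h1, h2, h3, h4⟩ | ⟨h1, h2, h3, h4⟩ <;>
    rcases hb with ⟨h1', h2', h3', h4'⟩ | ⟨h1', h2', h3', h4'⟩
  · rcases Nat.lt_or_gt_of_ne hab with h | h
    · have := h4 b h h2'
      rcases h1' with h | h
      · omega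
      · exact h.1 this
    · have := h4' a h h2
      rcases h1 with h | h
      · omega
      · exact h.1 this
  · exact h3 h3'
  · exact h3' h3
  · have hal := a.isLt
    have hbl := b.isLt
    rcases Nat.lt_or_gt_of_ne hab with h | h
    · have := h4' a h2 h
      rcases h1 with h | h
      · omega
      · exact this h.1
    · have := h4 b h2' h
      rcases h1' with h | h
      · omega
      · exact this h.1

theorem CyclicNext.right_unique {n : ℕ} {w : ℕ → Prop} (h0 : w 0) (hn : ¬ w (n + 1))
    {a b m : Fin (n + 2)} (ha : CyclicNext w m a) (hb : CyclicNext w m b) : a = b := by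
  -- A choice of successors is injective by `left_unique`, hence surjective on a finite set; so
  -- every candidate is the chosen successor of something, which must be `m`.
  choose g hg using exists_cyclicNext h0 hn
  have hinj : Function.Injective g := fun x y hxy => (hg x).left_unique (hxy ▸ hg y)
  obtain ⟨x, rfl⟩ := (Finite.injective_iff_surjective.1 hinj) a
  obtain ⟨y, rfl⟩ := (Finite.injective_iff_surjective.1 hinj) b
  rw [← ha.left_unique (hg x), ← hb.left_unique (hg y)]

/-! ### The cycle of states attached to a permutation of one letter less -/

open Classical in
/-- The permutation obtained from `ρ` by inserting a letter at `m`: in front of the letter `m` in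
its cycle if `m` is a weak excedance of `ρ`, and as a fixed point otherwise. -/
noncomputable def cycleState {n : ℕ} (ρ : Equiv.Perm (Fin n)) (m : Fin (n + 1)) :
    Equiv.Perm (Fin (n + 1)) :=
  if h : wexc ρ m then ins ρ (Fin.succ ⟨m, h.1⟩) m else ins ρ m m

theorem cycleState_castSucc {n : ℕ} {ρ : Equiv.Perm (Fin n)} {j : Fin n} (h : wexc ρ j) :
    cycleState ρ j.castSucc = ins ρ j.succ j.castSucc :=
  dif_pos h

theorem cycleState_of_not {n : ℕ} {ρ : Equiv.Perm (Fin n)} {m : Fin (n + 1)} (h : ¬ wexc ρ m) :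
    cycleState ρ m = ins ρ m m :=
  dif_neg h

theorem cycleState_cases {n : ℕ} (ρ : Equiv.Perm (Fin n)) (m : Fin (n + 1)) :
    (∃ j : Fin n, m = j.castSucc ∧ wexc ρ j ∧ cycleState ρ m = ins ρ j.succ j.castSucc) ∨
      (¬ wexc ρ m ∧ cycleState ρ m = ins ρ m m) := by
  by_cases h : wexc ρ m
  · exact Or.inl ⟨⟨m, h.1⟩, rfl, h, dif_pos h⟩
  · exact Or.inr ⟨h, dif_neg h⟩

theorem ins_descent_ne_ins_fixed {n : ℕ} (ρ ρ' : Equiv.Perm (Fin n)) (j : Fin n) :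
    ins ρ j.succ j.castSucc ≠ ins ρ' j.castSucc j.castSucc := by
  intro h
  have h1 := ins_same ρ j.succ j.castSucc
  rw [h] at h1
  exact (Fin.castSucc_lt_succ (i := j)).ne'
    ((ins ρ' _ _).injective (h1.trans (ins_same ρ' _ _).symm))

theorem cycleState_injective {n : ℕ} (m : Fin (n + 1)) :
    Function.Injective fun ρ : Equiv.Perm (Fin n) => cycleState ρ m := by
  intro ρ ρ' h
  simp only at h
  rcases cycleState_cases ρ m with ⟨j, hj, -, e⟩ | ⟨-, e⟩ <;>
    rcases cycleState_cases ρ' m with ⟨j', hj', -, e'⟩ | ⟨-, e'⟩ <;> rw [e, e'] at h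
  · obtain rfl := Fin.castSucc_injective _ (hj.symm.trans hj')
    exact ins_injective _ _ h
  · subst hj
    exact absurd h (ins_descent_ne_ins_fixed _ _ _)
  · subst hj'
    exact absurd h.symm (ins_descent_ne_ins_fixed _ _ _)
  · exact ins_injective _ _ h

/-- The factor is the rate at which the cycle leaves the state at `m`. Thus the flux along the cycle
is constant, equal to the weight of `ρ`. -/
theorem wt_cycleState {K : Type*} [Field K] (q α β : K) {n : ℕ} (ρ : Equiv.Perm (Fin (n + 1)))
    (hα : α ≠ 0) (hβ : β ≠ 0) (m : Fin (n + 2)) :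
    wt q α β ρ = wt q α β (cycleState ρ m) *
      if m = 0 then α else if m = Fin.last _ then β else 1 := by
  rcases cycleState_cases ρ m with ⟨j, rfl, hj, e⟩ | ⟨hm, e⟩
  · rw [e, wt_ins_descent q α β ρ hα j ((wexc_val ρ j).1 hj), if_neg (Fin.castSucc_lt_last j).ne]
    simp
  · have hm0 : m ≠ 0 := by rintro rfl; exact hm (wexc_zero ρ)
    rw [e, wt_ins_fixed q α β ρ hβ m hm0, if_neg hm0]
    intro k hk
    rw [← hk, wexc_val] at hm
    exact not_le.1 hm

/-- The weak excedances of `σ` arise from those of `π` by replacing `m` by `m + 1`. -/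
def Hops {n : ℕ} (π σ : Equiv.Perm (Fin n)) (m : ℕ) : Prop :=
  wexc π m ∧ ∀ k, wexc σ k ↔ k = m + 1 ∨ (wexc π k ∧ k ≠ m)

/-- The place of a hop can be read off from its two ends, so a pair of states belongs to inner steps
of the cycles at one place only. -/
theorem Hops.unique {n : ℕ} {π σ : Equiv.Perm (Fin n)} {m m' : ℕ} (h : Hops π σ m)
    (h' : Hops π σ m') : m = m' := by
  by_contra hne
  rcases (h.2 m).1 ((h'.2 m).2 (Or.inr ⟨h.1, hne⟩)) with h1 | h1
  · omega
  · exact h1.2 rfl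

/-- For both kinds of insertion, `m` is a weak excedance of the state and `m + 1` is not: there is a
particle ready to hop right. Elsewhere the pattern is that of `ρ`, shifted by one beyond `m + 1`. -/
theorem wexc_cycleState {n : ℕ} (ρ : Equiv.Perm (Fin n)) (m : Fin (n + 1)) (k : ℕ) :
    wexc (cycleState ρ m) k ↔
      (k ≤ m ∧ (wexc ρ k ∨ k = m)) ∨
        ((m : ℕ) < k ∧ wexc ρ (k - 1) ∧ (k = m + 1 → ¬ wexc ρ m)) := by
  rcases cycleState_cases ρ m with ⟨j, rfl, hj, e⟩ | ⟨hm, e⟩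
  · rw [e, wexc_ins_descent, Fin.val_castSucc]
    grind
  · rw [e, wexc_ins_fixed]
    grind

theorem hops_cycleState {n : ℕ} {ρ : Equiv.Perm (Fin (n + 1))} {m m' : Fin (n + 2)}
    (h : CyclicNext (wexc ρ) m m') (h0 : m ≠ 0) (hl : m ≠ Fin.last _) :
    Hops (cycleState ρ m) (cycleState ρ m') m := by
  refine ⟨by rw [wexc_cycleState]; simp, fun k => ?_⟩
  simp only [wexc_cycleState]
  simp only [CyclicNext, h0, hl, false_or, Fin.lt_def, ne_eq, not_false_eq_true, and_true] at h
  rcases h with ⟨h1, h2, h3, h4⟩ | ⟨h1, h2, h3, h4⟩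
  · have h5 := h4 k
    have h6 := h4 (k - 1)
    grind
  · have h5 := h4 k
    have h6 := h4 (k - 1)
    grind

theorem wexc_cycleState_of_last {n : ℕ} {ρ : Equiv.Perm (Fin (n + 1))} {m' : Fin (n + 2)}
    (h : CyclicNext (wexc ρ) (Fin.last _) m') (k : ℕ) (hk : wexc (cycleState ρ m') k) :
    wexc (cycleState ρ (Fin.last _)) k ∧ k ≠ n + 1 := by
  have hlt := hk.lt
  rw [wexc_cycleState] at hk ⊢
  simp only [CyclicNext, Fin.lt_def, Fin.val_last] at h
  rcases h with ⟨h1, h2, h3, h4⟩ | ⟨h1, h2, h3, h4⟩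
  · have := m'.isLt; omega
  · have h5 := h4 (k - 1)
    rw [Fin.val_last]
    grind

theorem hops_mul_swap {n : ℕ} {π : Equiv.Perm (Fin n)} {i i' : Fin n} (hi : (i' : ℕ) = i + 1)
    (h1 : i < π i) (h2 : π i' < i) : Hops π (π * Equiv.swap i i') i := by
  refine ⟨(wexc_val π i).2 h1.le, fun k => ?_⟩
  by_cases hk : k < n
  · obtain ⟨x, rfl⟩ : ∃ x : Fin n, (x : ℕ) = k := ⟨⟨k, hk⟩, rfl⟩
    rw [wexc_val, wexc_val, ← hi, Equiv.Perm.mul_apply, ← Fin.ext_iff, Ne, ← Fin.ext_iff]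
    by_cases hx : x = i
    · subst hx
      rw [Equiv.swap_apply_left]
      refine iff_of_false (not_le.2 h2) ?_
      rintro (h | h)
      · rw [← h] at hi; omega
      · exact h.2 rfl
    · by_cases hx' : x = i'
      · subst hx'
        rw [Equiv.swap_apply_right]
        rw [Fin.lt_def] at h1
        exact iff_of_true (by rw [Fin.le_def]; omega) (Or.inl rfl)
      · rw [Equiv.swap_apply_of_ne_of_ne hx hx']
        simp [hx, hx']
  · refine iff_of_false (fun h => hk h.1) ?_
    rintro (h | h)
    · have := i'.isLt; omega
    · exact hk h.1.1

/-! ### The transitions of the chain in terms of the cycles -/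

/-- There is a step of the cycle of `ρ` from `π`, at `m`, to `σ`. -/
def CycleStep {n : ℕ} (π σ : Equiv.Perm (Fin (n + 1))) (ρ : Equiv.Perm (Fin n))
    (m : Fin (n + 1)) : Prop :=
  ∃ m', CyclicNext (wexc ρ) m m' ∧ π = cycleState ρ m ∧ σ = cycleState ρ m'

/-- Since `0` is always a weak excedance, the state at `0` has the value `0` at position `1`, and
every permutation with this property arises so. Beyond position `1` the weak excedances are those of
`ρ` moved by one, so the last place before a non-excedance of `π` is itself a non-excedance of `ρ`.
-/
theorem entersLeft_iff {n : ℕ} (π σ : Equiv.Perm (Fin (n + 2))) :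
    EntersLeft π σ ↔ ∃ ρ, CycleStep π σ ρ 0 := by
  have h01 : ∀ ρ : Equiv.Perm (Fin (n + 1)), cycleState ρ 0 = ins ρ (Fin.succ 0) 0 :=
    fun ρ => cycleState_castSucc (j := 0) (wexc_zero ρ)
  constructor
  · rintro ⟨a, p, ha, hπ, hL, rfl⟩
    obtain rfl : a = Fin.succ 0 := Fin.ext (by simp [ha])
    obtain ⟨ρ, hρ⟩ := exists_ins π (Fin.succ 0)
    rw [hπ] at hρ
    subst hρ
    rw [lastBeforeNonexc_iff] at hL
    obtain ⟨h1, h2, h3⟩ := hL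
    rw [Fin.val_succ, Fin.val_zero] at h1 h2
    have hw := wexc_ins_descent ρ 0
    rw [Fin.castSucc_zero, Fin.val_zero] at hw
    have hp : ¬ wexc ρ p := fun h => h3 ((hw _).2 (Or.inr ⟨by omega, h⟩))
    refine ⟨ρ, p, Or.inl ⟨Or.inl rfl, Fin.lt_def.2 (by rw [Fin.val_zero]; omega), hp, fun k hk hk' => ?_⟩,
      (h01 ρ).symm, ?_⟩
    · rw [Fin.val_zero] at hk
      have := (hw (k + 1)).1 (h2 (k + 1) (by omega) (by omega))
      rw [Nat.add_sub_cancel] at this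
      rcases this with h | h
      · omega
      · exact h.2
    · rw [cycleState_of_not hp, ← normMove_ins ρ (Fin.succ 0) p, ← collapseAt_ins_descent]
      rfl
  · rintro ⟨ρ, p, hR, rfl, rfl⟩
    rw [h01]
    have hw := wexc_ins_descent ρ 0
    rw [Fin.castSucc_zero, Fin.val_zero] at hw
    rcases hR with ⟨-, h1, h2, h3⟩ | ⟨-, h1, -⟩
    · refine ⟨Fin.succ 0, p, by simp, ins_same _ _ _, ?_, ?_⟩
      · rw [lastBeforeNonexc_iff]
        rw [Fin.lt_def, Fin.val_zero] at h1
        rw [Fin.val_succ, Fin.val_zero]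
        refine ⟨by omega, fun k hk hk' => (hw k).2 (Or.inr ⟨hk, h3 _ ?_ ?_⟩), fun h => ?_⟩
        · rw [Fin.val_zero]; omega
        · omega
        · rcases (hw _).1 h with h | h
          · omega
          · exact h2 h.2
      · rw [cycleState_of_not h2, ← normMove_ins ρ (Fin.succ 0) p, ← collapseAt_ins_descent]
        rfl
    · exact absurd h1 (Fin.not_lt_zero _)

theorem exitsRight_iff {n : ℕ} (π σ : Equiv.Perm (Fin (n + 2))) :
    ExitsRight π σ ↔ ∃ ρ, CycleStep π σ ρ (Fin.last _) := by
  have hlast : ∀ ρ : Equiv.Perm (Fin (n + 1)),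
      cycleState ρ (Fin.last _) = ins ρ (Fin.last _) (Fin.last _) :=
    fun ρ => cycleState_of_not fun h => by simpa using h.lt
  constructor
  · rintro ⟨j, p, hπ, hP, hp, rfl⟩
    obtain ⟨ρ, hρ⟩ := exists_ins π (Fin.last _)
    rw [hπ] at hρ
    subst hρ
    rw [prevWeakExc_iff] at hP
    obtain ⟨h1, h2, h3⟩ := hP
    rw [Fin.val_last] at h1 h3
    have hw : ∀ k < n + 1, (wexc (ins ρ (Fin.last (n + 1)) (Fin.last (n + 1))) k ↔ wexc ρ k) := by
      intro k hk
      rw [wexc_ins_fixed, Fin.val_last]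
      grind
    obtain ⟨j, rfl⟩ : ∃ j' : Fin (n + 1), j'.castSucc = j := ⟨⟨j, h1⟩, rfl⟩
    obtain rfl : p = j.succ := Fin.ext (by simp [hp])
    have hj : wexc ρ j := (hw _ h1).1 h2
    refine ⟨ρ, j.castSucc, Or.inr ⟨Or.inl rfl, Fin.castSucc_lt_last j, hj,
      fun k hk hk' h => h3 k hk hk' ((hw k hk').2 h)⟩, (hlast ρ).symm, ?_⟩
    rw [collapseAt_ins_fixed, cycleState_castSucc hj,
      normMove_insertBefore _ _ _ (Fin.castSucc_lt_last j)]
  · rintro ⟨ρ, m', hR, rfl, rfl⟩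
    rw [hlast]
    have hw : ∀ k < n + 1, (wexc (ins ρ (Fin.last (n + 1)) (Fin.last (n + 1))) k ↔ wexc ρ k) := by
      intro k hk
      rw [wexc_ins_fixed, Fin.val_last]
      grind
    rcases hR with ⟨-, h1, -⟩ | ⟨-, h1, h2, h3⟩
    · exact absurd h1 (not_lt.2 (Fin.le_last _))
    · obtain ⟨j, rfl⟩ : ∃ j' : Fin (n + 1), j'.castSucc = m' := ⟨⟨m', h1⟩, rfl⟩
      refine ⟨j.castSucc, j.succ, ins_same _ _ _, ?_, by simp, ?_⟩
      · rw [prevWeakExc_iff]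
        exact ⟨h1, (hw _ h1).2 h2, fun k hk hk' h => h3 k hk hk' ((hw k hk').1 h)⟩
      · rw [collapseAt_ins_fixed, cycleState_castSucc h2, normMove_insertBefore _ _ _ h1]

/-- The fixed point `i` is the inserted letter. That `i'` is a non-excedance of `π` means that `i`
is a non-excedance of `ρ`. -/
theorem hopsRight₁_iff {n : ℕ} (π σ : Equiv.Perm (Fin (n + 2))) :
    HopsRight₁ π σ ↔ ∃ ρ m, (m ≠ 0 ∧ m ≠ Fin.last _ ∧ ¬ wexc ρ m) ∧ CycleStep π σ ρ m := by
  constructor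
  · rintro ⟨i, i', p, hi0, hi, hπ, hπ', hL, rfl⟩
    obtain ⟨ρ, hρ⟩ := exists_ins π i
    rw [hπ] at hρ
    subst hρ
    rw [lastBeforeNonexc_iff] at hL
    obtain ⟨h1, h2, h3⟩ := hL
    have hw := wexc_ins_fixed ρ i
    have hil : i ≠ Fin.last _ := by
      rintro rfl
      have := i'.isLt
      rw [Fin.val_last] at hi; omega
    have hiw : ¬ wexc ρ i := by
      intro h
      refine not_le.2 hπ' ((wexc_val _ i').1 ((hw _).2 (Or.inr (Or.inr ?_))))
      rw [hi, Nat.add_sub_cancel]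
      exact ⟨by omega, h⟩
    have hp : ¬ wexc ρ p := fun h => h3 ((hw _).2 (Or.inr (Or.inr ⟨by omega, h⟩)))
    refine ⟨ρ, i, ⟨hi0, hil, hiw⟩, p, Or.inl ⟨Or.inr ⟨hiw, hil⟩, Fin.lt_def.2 (by omega), hp,
      fun k hk hk' => ?_⟩, (cycleState_of_not hiw).symm, ?_⟩
    · have := (hw (k + 1)).1 (h2 (k + 1) (by omega) (by omega))
      rw [Nat.add_sub_cancel] at this
      rcases this with h | h | h
      · omega
      · omega
      · exact h.2
    · rw [collapseAt_ins_fixed, normMove_ins, cycleState_of_not hp]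
  · rintro ⟨ρ, i, ⟨hi0, hil, hiw⟩, p, hR, rfl, rfl⟩
    have hw := wexc_ins_fixed ρ i
    rw [cycleState_of_not hiw]
    rcases hR with ⟨-, h1, h2, h3⟩ | ⟨h1, -⟩
    · have hil' : (i : ℕ) ≠ n + 1 := fun h => hil (Fin.ext h)
      have := i.isLt
      rw [Fin.lt_def] at h1
      refine ⟨i, ⟨i + 1, by omega⟩, p, hi0, rfl, ins_same _ _ _, ?_, ?_, ?_⟩
      · rw [← not_le, ← wexc_val, hw]
        simp only [Nat.add_sub_cancel]
        rintro (h | h | h)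
        · omega
        · omega
        · exact hiw h.2
      · rw [lastBeforeNonexc_iff]
        simp only
        refine ⟨by omega, fun k hk hk' => (hw k).2 (Or.inr (Or.inr
          ⟨by omega, h3 (k - 1) (by omega) (by omega)⟩)), fun h => ?_⟩
        rcases (hw _).1 h with h | h | h
        · omega
        · omega
        · exact h2 h.2
      · rw [collapseAt_ins_fixed, normMove_ins, cycleState_of_not h2]
    · rcases h1 with h1 | h1
      · exact absurd h1 hil
      · exact absurd h1.1 hiw

/-- The value `i` at position `i'` marks the inserted letter. That `i` is a strict excedance of `π`
matches `i` being a weak excedance of `ρ`, since `i` cannot also be the value at `i`. -/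
theorem hopsRight₃_iff {n : ℕ} (π σ : Equiv.Perm (Fin (n + 2))) :
    HopsRight₃ π σ ↔ ∃ ρ m, (m ≠ 0 ∧ m ≠ Fin.last _ ∧ wexc ρ m) ∧ CycleStep π σ ρ m := by
  constructor
  · rintro ⟨i, i', j, p, hi0, hi, hπ, hπ', hP, hp, rfl⟩
    have hin := i'.isLt
    obtain ⟨i, rfl⟩ : ∃ k : Fin (n + 1), k.castSucc = i := ⟨⟨i, by omega⟩, rfl⟩
    obtain rfl : i' = i.succ := Fin.ext (by simp [hi])
    obtain ⟨ρ, hρ⟩ := exists_ins π i.succ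
    rw [hπ'] at hρ
    subst hρ
    rw [prevWeakExc_iff] at hP
    obtain ⟨h1, h2, h3⟩ := hP
    have hw := wexc_ins_descent ρ i
    rw [Fin.val_castSucc] at h1 h3
    obtain ⟨j, rfl⟩ : ∃ k : Fin (n + 1), k.castSucc = j := ⟨⟨j, by omega⟩, rfl⟩
    obtain rfl : p = j.succ := Fin.ext (by simp [hp])
    rw [Fin.val_castSucc] at h1 h2 h3
    have hiw : wexc ρ i := by
      have h := (hw i).1 ((wexc_val _ i.castSucc).2 hπ.le)
      rcases h with h | h
      · exact h.2
      · omega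
    have hj : wexc ρ j := by
      rcases (hw j).1 h2 with h | h
      · exact h.2
      · omega
    refine ⟨ρ, i.castSucc, ⟨hi0, (Fin.castSucc_lt_last i).ne, hiw⟩, j.castSucc,
      Or.inr ⟨Or.inr ⟨hiw, hi0⟩, h1, hj, fun k hk hk' h => ?_⟩, (cycleState_castSucc hiw).symm, ?_⟩
    · rw [Fin.val_castSucc] at hk hk'
      exact h3 k hk hk' ((hw k).2 (Or.inl ⟨by omega, h⟩))
    · rw [collapseAt_ins_descent, normMove_insertBefore, cycleState_castSucc hj]
      rw [Fin.lt_def, Fin.val_castSucc, Fin.val_succ]; omega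
  · rintro ⟨ρ, i, ⟨hi0, hil, hiw⟩, j, hR, rfl, rfl⟩
    obtain ⟨i, rfl⟩ : ∃ k : Fin (n + 1), k.castSucc = i := ⟨⟨i, hiw.lt⟩, rfl⟩
    rcases hR with ⟨h1, -⟩ | ⟨-, h1, h2, h3⟩
    · rcases h1 with h1 | h1
      · exact absurd h1 hi0
      · exact absurd hiw h1.1
    · obtain ⟨j, rfl⟩ : ∃ k : Fin (n + 1), k.castSucc = j := ⟨⟨j, h2.lt⟩, rfl⟩
      have hw := wexc_ins_descent ρ i
      rw [Fin.val_castSucc] at hiw h2 h3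
      rw [Fin.val_castSucc] at h3
      rw [Fin.lt_def, Fin.val_castSucc, Fin.val_castSucc] at h1
      rw [cycleState_castSucc hiw]
      refine ⟨i.castSucc, i.succ, j.castSucc, j.succ, hi0, by simp, ?_, ins_same _ _ _, ?_,
        by simp, ?_⟩
      · refine lt_of_le_of_ne ((wexc_val _ i.castSucc).1 ((hw i).2 (Or.inl ⟨by omega, hiw⟩))) ?_
        intro h
        have := (ins ρ i.succ i.castSucc).injective (h.symm.trans (ins_same _ _ _).symm)
        exact (Fin.castSucc_lt_succ (i := i)).ne this
      · rw [prevWeakExc_iff, Fin.val_castSucc, Fin.val_castSucc]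
        refine ⟨h1, (hw j).2 (Or.inl ⟨by omega, h2⟩), fun k hk hk' h => ?_⟩
        rcases (hw k).1 h with h | h
        · exact h3 k hk hk' h.2
        · omega
      · rw [collapseAt_ins_descent, normMove_insertBefore, cycleState_castSucc h2]
        rw [Fin.lt_def, Fin.val_castSucc, Fin.val_succ]; omega

theorem cycleStep_iff {n : ℕ} {ρ : Equiv.Perm (Fin (n + 1))} {g : Fin (n + 2) → Fin (n + 2)}
    (hg : ∀ m, CyclicNext (wexc ρ) m (g m)) (π σ : Equiv.Perm (Fin (n + 2))) (m : Fin (n + 2)) :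
    CycleStep π σ ρ m ↔ π = cycleState ρ m ∧ σ = cycleState ρ (g m) := by
  constructor
  · rintro ⟨m', h, h1, h2⟩
    obtain rfl := CyclicNext.right_unique (wexc_zero ρ) (fun h => by simpa using h.lt) h (hg m)
    exact ⟨h1, h2⟩
  · rintro ⟨h1, h2⟩
    exact ⟨g m, hg m, h1, h2⟩

theorem exists_next {n : ℕ} (ρ : Equiv.Perm (Fin (n + 1))) :
    ∃ g : Equiv.Perm (Fin (n + 2)), ∀ m, CyclicNext (wexc ρ) m (g m) := by
  choose g hg using exists_cyclicNext (wexc_zero ρ) (fun h : wexc ρ (n + 1) => by simpa using h.lt)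
  have hinj : Function.Injective g := fun x y hxy => (hg x).left_unique (hxy ▸ hg y)
  exact ⟨Equiv.ofBijective g (Finite.injective_iff_bijective.1 hinj), hg⟩

theorem CycleStep.hops {n : ℕ} {ρ : Equiv.Perm (Fin (n + 1))} {π σ : Equiv.Perm (Fin (n + 2))}
    {m : Fin (n + 2)} (h : CycleStep π σ ρ m) (h0 : m ≠ 0) (hl : m ≠ Fin.last _) :
    Hops π σ m := by
  obtain ⟨m', h, rfl, rfl⟩ := h
  exact hops_cycleState h h0 hl

theorem CycleStep.eq_left {n : ℕ} {ρ ρ' : Equiv.Perm (Fin n)}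
    {π σ : Equiv.Perm (Fin (n + 1))} {m : Fin (n + 1)} (h : CycleStep π σ ρ m)
    (h' : CycleStep π σ ρ' m) : ρ = ρ' := by
  obtain ⟨_, -, e, -⟩ := h
  obtain ⟨_, -, e', -⟩ := h'
  exact cycleState_injective m (e.symm.trans e')

/-- By `Hops.unique` both steps take place at `m`. There a state of the cycle has the value `m` at
`m` or at `m + 1`, and the second form of hopping right excludes both. -/
theorem not_hopsRight₂_of_cycleStep {n : ℕ} {ρ : Equiv.Perm (Fin (n + 1))}
    {π σ : Equiv.Perm (Fin (n + 2))} {m : Fin (n + 2)} (h : CycleStep π σ ρ m) (h0 : m ≠ 0)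
    (hl : m ≠ Fin.last _) : ¬ HopsRight₂ π σ := by
  rintro ⟨i, i', hi0, hi, h1, h2, hσ⟩
  have hh := hops_mul_swap hi h1 h2
  rw [← hσ] at hh
  obtain rfl : m = i := Fin.ext ((h.hops h0 hl).unique hh)
  obtain ⟨m', -, e, -⟩ := h
  rcases cycleState_cases ρ m with ⟨j, rfl, -, e'⟩ | ⟨-, e'⟩ <;> rw [e'] at e <;> subst e
  · obtain rfl : i' = j.succ := Fin.ext (by simp [hi])
    rw [ins_same] at h2
    exact lt_irrefl _ h2
  · rw [ins_same] at h1
    exact lt_irrefl _ h1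

/-! ### Flux along the cycles and global balance -/

theorem ite_eq_sum_ite {ι R : Type*} [Fintype ι] [AddCommMonoid R] {P : Prop} [Decidable P]
    {Q : ι → Prop} [DecidablePred Q] {c : R} {g : ι → R} (hP : P ↔ ∃ i, Q i)
    (hQ : ∀ i j, Q i → Q j → i = j) (hg : ∀ i, Q i → g i = c) :
    (if P then c else 0) = ∑ i, if Q i then g i else 0 := by
  by_cases h : P
  · obtain ⟨i, hi⟩ := hP.1 h
    rw [if_pos h, Finset.sum_eq_single i, if_pos hi, hg i hi]
    · intro j _ hj
      exact if_neg fun hj' => hj (hQ _ _ hj' hi)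
    · simp
  · rw [if_neg h, Finset.sum_eq_zero]
    exact fun i _ => if_neg fun hi => h (hP.2 ⟨i, hi⟩)

theorem ite_eq_add_ite_add_ite {R : Type*} [AddCommMonoid R] {a b c : Prop} [Decidable c]
    [Decidable (a ∧ c)] [Decidable (b ∧ c)]
    [Decidable ((¬ a ∧ ¬ b) ∧ c)] (h : ¬ (a ∧ b)) (r : R) :
    (if c then r else 0) =
      (if a ∧ c then r else 0) + (if (¬ a ∧ ¬ b) ∧ c then r else 0) + if b ∧ c then r else 0 := by
  by_cases ha : a <;> by_cases hb : b <;> by_cases hc : c <;> simp_all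

open Classical in
/-- The flux along the steps of the cycles from `π` to `σ`. -/
noncomputable def cycleFlux (q α β : ℝ) {n : ℕ} (π σ : Equiv.Perm (Fin (n + 2))) : ℝ :=
  ∑ x : Equiv.Perm (Fin (n + 1)) × Fin (n + 2), if CycleStep π σ x.1 x.2 then wt q α β x.1 else 0

/-- The flux splits into a part that circulates in the cycles and a part that is reversible. A
transition of the circulating kinds determines `ρ` and `m`, so its indicator is a sum over cycle
steps with a single term. -/
theorem wt_mul_rate {q α β : ℝ} (hα : α ≠ 0) (hβ : β ≠ 0) {n : ℕ}
    (π σ : Equiv.Perm (Fin (n + 2))) :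
    wt q α β π * rate q α β π σ = cycleFlux q α β π σ +
      ((if HopsRight₂ π σ then wt q α β π else 0) +
        if HopsLeft π σ then wt q α β π * q else 0) := by
  classical
  have hw : ∀ (ρ : Equiv.Perm (Fin (n + 1))) m, CycleStep π σ ρ m → wt q α β ρ =
      wt q α β π * if m = 0 then α else if m = Fin.last _ then β else 1 := by
    rintro ρ m ⟨m', -, rfl, -⟩
    exact wt_cycleState q α β ρ hα hβ m
  have h0l : (0 : Fin (n + 2)) ≠ Fin.last _ := Fin.last_pos.ne
  have e1 : (if EntersLeft π σ then wt q α β π * α else 0) =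
      ∑ x : Equiv.Perm (Fin (n + 1)) × Fin (n + 2),
        if x.2 = 0 ∧ CycleStep π σ x.1 x.2 then wt q α β x.1 else 0 := by
    refine ite_eq_sum_ite ?_ ?_ ?_
    · rw [entersLeft_iff]
      exact ⟨fun ⟨ρ, h⟩ => ⟨(ρ, 0), rfl, h⟩, fun ⟨⟨ρ, m⟩, h1, h2⟩ => ⟨ρ, by obtain rfl := h1; exact h2⟩⟩
    · rintro ⟨ρ, m⟩ ⟨ρ', m'⟩ ⟨rfl, h⟩ ⟨rfl, h'⟩
      exact Prod.ext (h.eq_left h') rfl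
    · rintro ⟨ρ, m⟩ ⟨rfl, h⟩
      rw [hw _ _ h, if_pos rfl]
  have e2 : (if ExitsRight π σ then wt q α β π * β else 0) =
      ∑ x : Equiv.Perm (Fin (n + 1)) × Fin (n + 2),
        if x.2 = Fin.last _ ∧ CycleStep π σ x.1 x.2 then wt q α β x.1 else 0 := by
    refine ite_eq_sum_ite ?_ ?_ ?_
    · rw [exitsRight_iff]
      exact ⟨fun ⟨ρ, h⟩ => ⟨(ρ, _), rfl, h⟩, fun ⟨⟨ρ, m⟩, h1, h2⟩ => ⟨ρ, by obtain rfl := h1; exact h2⟩⟩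
    · rintro ⟨ρ, m⟩ ⟨ρ', m'⟩ ⟨rfl, h⟩ ⟨rfl, h'⟩
      exact Prod.ext (h.eq_left h') rfl
    · rintro ⟨ρ, m⟩ ⟨rfl, h⟩
      rw [hw _ _ h, if_neg h0l.symm, if_pos rfl]
  have e3 : (if HopsRight₁ π σ ∨ HopsRight₃ π σ then wt q α β π else 0) =
      ∑ x : Equiv.Perm (Fin (n + 1)) × Fin (n + 2),
        if (x.2 ≠ 0 ∧ x.2 ≠ Fin.last _) ∧ CycleStep π σ x.1 x.2 then wt q α β x.1 else 0 := by
    refine ite_eq_sum_ite ?_ ?_ ?_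
    · rw [hopsRight₁_iff, hopsRight₃_iff]
      constructor
      · rintro (⟨ρ, m, h, h'⟩ | ⟨ρ, m, h, h'⟩)
        · exact ⟨(ρ, m), ⟨h.1, h.2.1⟩, h'⟩
        · exact ⟨(ρ, m), ⟨h.1, h.2.1⟩, h'⟩
      · rintro ⟨⟨ρ, m⟩, h, h'⟩
        by_cases hm : wexc ρ m
        · exact Or.inr ⟨ρ, m, ⟨h.1, h.2, hm⟩, h'⟩
        · exact Or.inl ⟨ρ, m, ⟨h.1, h.2, hm⟩, h'⟩
    · rintro ⟨ρ, m⟩ ⟨ρ', m'⟩ ⟨h1, h⟩ ⟨h1', h'⟩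
      obtain rfl : m = m' := Fin.ext ((h.hops h1.1 h1.2).unique (h'.hops h1'.1 h1'.2))
      exact Prod.ext (h.eq_left h') rfl
    · rintro ⟨ρ, m⟩ ⟨h1, h⟩
      rw [hw _ _ h, if_neg h1.1, if_neg h1.2, mul_one]
  have e4 : (if HopsRight π σ then wt q α β π else 0) =
      (if HopsRight₁ π σ ∨ HopsRight₃ π σ then wt q α β π else 0) +
        if HopsRight₂ π σ then wt q α β π else 0 := by
    by_cases h2 : HopsRight₂ π σ
    · have h13 : ¬ (HopsRight₁ π σ ∨ HopsRight₃ π σ) := by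
        rw [hopsRight₁_iff, hopsRight₃_iff]
        rintro (⟨ρ, m, h, h'⟩ | ⟨ρ, m, h, h'⟩)
        · exact not_hopsRight₂_of_cycleStep h' h.1 h.2.1 h2
        · exact not_hopsRight₂_of_cycleStep h' h.1 h.2.1 h2
      rw [if_pos (Or.inr (Or.inl h2)), if_neg h13, if_pos h2, zero_add]
    · rw [if_neg h2, add_zero]
      refine if_congr ?_ rfl rfl
      exact ⟨fun h => h.elim Or.inl fun h => h.elim (fun h => absurd h h2) Or.inr,
        fun h => h.elim Or.inl fun h => Or.inr (Or.inr h)⟩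
  have e5 : cycleFlux q α β π σ = (if EntersLeft π σ then wt q α β π * α else 0) +
      (if HopsRight₁ π σ ∨ HopsRight₃ π σ then wt q α β π else 0) +
      if ExitsRight π σ then wt q α β π * β else 0 := by
    rw [e1, e2, e3, ← Finset.sum_add_distrib, ← Finset.sum_add_distrib]
    refine Finset.sum_congr rfl fun x _ => ?_
    exact ite_eq_add_ite_add_ite (fun h => h0l (h.1.symm.trans h.2)) _
  rw [e5, rate, mul_add, mul_add, mul_add, mul_ite, mul_ite, mul_ite, mul_ite, mul_zero, mul_one,
    e4]
  ring

/-- The successor map of each cycle is a permutation of its places and all its steps carry the same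
flux, so inflow and outflow are reindexings of each other. -/
theorem sum_cycleFlux (q α β : ℝ) {n : ℕ} (σ : Equiv.Perm (Fin (n + 2))) :
    ∑ π, cycleFlux q α β π σ = ∑ π, cycleFlux q α β σ π := by
  classical
  unfold cycleFlux
  rw [Finset.sum_comm, Finset.sum_comm (s := Finset.univ (α := Equiv.Perm (Fin (n + 2)))),
    Fintype.sum_prod_type, Fintype.sum_prod_type]
  refine Finset.sum_congr rfl fun ρ _ => ?_
  obtain ⟨g, hg⟩ := exists_next ρ
  simp only [cycleStep_iff hg]
  have h1 : ∀ m, (∑ π, if π = cycleState ρ m ∧ σ = cycleState ρ (g m) then wt q α β ρ else 0) =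
      if σ = cycleState ρ (g m) then wt q α β ρ else 0 := by
    intro m
    simp only [ite_and, Finset.sum_ite_eq', Finset.mem_univ, if_true]
  have h2 : ∀ m, (∑ π, if σ = cycleState ρ m ∧ π = cycleState ρ (g m) then wt q α β ρ else 0) =
      if σ = cycleState ρ m then wt q α β ρ else 0 := by
    intro m
    simp only [and_comm (a := σ = _), ite_and, Finset.sum_ite_eq', Finset.mem_univ, if_true]
  simp only [h1, h2]
  exact Equiv.sum_comp g fun m => if σ = cycleState ρ m then wt q α β ρ else 0

theorem hopsLeft_iff {N : ℕ} (π σ : Equiv.Perm (Fin (N + 1))) :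
    HopsLeft π σ ↔ HopsRight₂ σ π := by
  constructor
  · rintro ⟨i, i', hi, h1, h2, rfl⟩
    refine ⟨i, i', ?_, hi, ?_, ?_, ?_⟩
    · rintro rfl; simp at h1
    · rw [Equiv.Perm.mul_apply, Equiv.swap_apply_left, Fin.lt_def]
      rw [Fin.le_def] at h2; omega
    · rwa [Equiv.Perm.mul_apply, Equiv.swap_apply_right]
    · rw [mul_assoc, Equiv.swap_mul_self, mul_one]
  · rintro ⟨i, i', h0, hi, h1, h2, rfl⟩
    refine ⟨i, i', hi, ?_, ?_, ?_⟩
    · rwa [Equiv.Perm.mul_apply, Equiv.swap_apply_left]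
    · rw [Equiv.Perm.mul_apply, Equiv.swap_apply_right, Fin.le_def]
      rw [Fin.lt_def] at h1; omega
    · rw [mul_assoc, Equiv.swap_mul_self, mul_one]

theorem HopsRight₂.wt_eq (q α β : ℝ) {N : ℕ} {π σ : Equiv.Perm (Fin (N + 1))}
    (h : HopsRight₂ π σ) : wt q α β π = wt q α β σ * q := by
  obtain ⟨i, i', h0, hi, h1, h2, rfl⟩ := h
  rw [wt_mul_swap q α β π i i' hi h1 h2, mul_comm]

/-- The weights of the permutations satisfy the global balance equations. -/
theorem sum_wt_mul_rate {q α β : ℝ} (hα : α ≠ 0) (hβ : β ≠ 0) {N : ℕ}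
    (σ : Equiv.Perm (Fin (N + 1))) :
    ∑ π, wt q α β π * rate q α β π σ = ∑ π, wt q α β σ * rate q α β σ π := by
  cases N with
  | zero =>
    exact Finset.sum_congr rfl fun π _ => by
      rw [show π = σ from Equiv.ext fun x => Subsingleton.elim (α := Fin 1) _ _]
  | succ n =>
    simp only [wt_mul_rate hα hβ, Finset.sum_add_distrib, sum_cycleFlux]
    -- The inflow by right hops is paired with the outflow by left hops, and conversely.
    rw [add_comm (∑ π, if HopsRight₂ σ π then _ else _)]
    congr 2 <;> refine Finset.sum_congr rfl fun π _ => ?_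
    · rw [← Eq.symm (if_congr (hopsLeft_iff σ π) rfl rfl)]
      split_ifs with h
      · exact h.wt_eq q α β
      · rfl
    · rw [if_congr (hopsLeft_iff π σ) rfl rfl]
      split_ifs with h
      · exact (h.wt_eq q α β).symm
      · rfl

/-! ### Uniqueness of the solution of the balance equations -/

open Matrix in
/-- If from every state some fixed state can be reached, then the balance equations have at most
one normalized solution. -/
theorem eq_of_balance {ι : Type*} [Fintype ι] [DecidableEq ι] {r : ι → ι → ℝ}
    (hr : ∀ i j, 0 ≤ r i j) (Φ : ι → ℕ) (s : ι) (hΦ : ∀ i, i ≠ s → ∃ j, 0 < r i j ∧ Φ j < Φ i)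
    {μ ν : ι → ℝ} (hμ : ∀ j, ∑ i, μ i * r i j = ∑ i, μ j * r j i)
    (hν : ∀ j, ∑ i, ν i * r i j = ∑ i, ν j * r j i) (hs : ∑ i, μ i = ∑ i, ν i) : μ = ν := by
  -- Maximum principle: at a maximizer of `h` all terms are nonpositive. If they add up to zero,
  -- each target of a positive rate is again a maximizer.
  have hmax : ∀ (h : ι → ℝ) (c : ℝ), (∀ i, ∑ j, r i j * (h j - h i) = c) →
      c ≤ 0 ∧ (c = 0 → ∀ i, h i ≤ h s) := by
    intro h c hc
    obtain ⟨i₀, -, hi₀⟩ := Finset.exists_max_image Finset.univ h ⟨s, Finset.mem_univ s⟩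
    have hi₀ : ∀ j, h j ≤ h i₀ := fun j => hi₀ j (Finset.mem_univ j)
    have hle : ∀ i, h i = h i₀ → ∀ j, r i j * (h j - h i) ≤ 0 := fun i hi j =>
      mul_nonpos_of_nonneg_of_nonpos (hr i j) (by linarith [hi₀ j])
    refine ⟨hc i₀ ▸ Finset.sum_nonpos fun j _ => hle i₀ rfl j, fun hc0 => ?_⟩
    -- Following steps that decrease `Φ` carries the maximum to `s`.
    have key : ∀ n i, Φ i = n → h i = h i₀ → h s = h i₀ := by
      intro n
      induction n using Nat.strong_induction_on with
      | _ n ih =>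
        intro i hin hi
        by_cases his : i = s
        · rw [← his, hi]
        · obtain ⟨j, hj, hji⟩ := hΦ i his
          have h0 := (Finset.sum_eq_zero_iff_of_nonpos fun j _ => hle i hi j).1
            ((hc i).trans hc0) j (Finset.mem_univ j)
          rcases mul_eq_zero.1 h0 with h0 | h0
          · exact absurd h0 hj.ne'
          · exact ih _ (hin ▸ hji) j rfl (by linarith)
    intro i
    rw [key _ i₀ rfl rfl]
    exact hi₀ i
  -- The generator plus the all-ones matrix. The latter removes the constants from the right kernel
  -- and is invisible to differences of vectors with equal sums on the left.
  let M : Matrix ι ι ℝ := Matrix.of fun i j => r i j - (if i = j then ∑ k, r i k else 0) + 1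
  have hM : ∀ v : ι → ℝ, M *ᵥ v = 0 → v = 0 := by
    intro v hv
    have h1 : ∀ i, ∑ j, r i j * (v j - v i) = - ∑ j, v j := by
      intro i
      have := congrFun hv i
      simp only [M, Matrix.mulVec, dotProduct, Matrix.of_apply, add_mul, sub_mul, one_mul,
        ite_mul, zero_mul, Finset.sum_add_distrib, Finset.sum_sub_distrib, Finset.sum_ite_eq,
        Finset.mem_univ, if_true, Pi.zero_apply, Finset.sum_mul] at this
      simp only [mul_sub, Finset.sum_sub_distrib]
      linarith
    have h2 : ∀ i, ∑ j, r i j * ((-v) j - (-v) i) = ∑ j, v j := by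
      intro i
      rw [← neg_inj, ← h1 i, ← Finset.sum_neg_distrib]
      exact Finset.sum_congr rfl fun j _ => by simp only [Pi.neg_apply]; ring
    have h3 := hmax _ _ h1
    have h4 := hmax _ _ h2
    have h5 : ∑ j, v j = 0 := by linarith [h3.1, h4.1]
    have h6 : ∀ i, v i = v s := fun i => le_antisymm (h3.2 (by rw [h5, neg_zero]) i)
      (by have := h4.2 h5 i; simp only [Pi.neg_apply] at this; linarith)
    have h7 : (Fintype.card ι : ℝ) * v s = 0 := by
      rw [← h5, Finset.sum_congr rfl fun i _ => h6 i]
      simp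
    have : Nonempty ι := ⟨s⟩
    have hcard : (Fintype.card ι : ℝ) ≠ 0 := Nat.cast_ne_zero.2 Fintype.card_ne_zero
    funext i
    rw [h6 i]
    exact (mul_eq_zero.1 h7).resolve_left hcard
  by_contra hne
  have hd : ∃ v, v ≠ 0 ∧ v ᵥ* M = 0 := by
    refine ⟨μ - ν, sub_ne_zero.2 hne, funext fun j => ?_⟩
    have h1 := hμ j
    have h2 := hν j
    rw [← Finset.mul_sum] at h1 h2
    simp only [M, Matrix.vecMul, dotProduct, Matrix.of_apply, mul_add, mul_sub, mul_one, mul_ite,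
      mul_zero, Finset.sum_add_distrib, Finset.sum_sub_distrib, Finset.sum_ite_eq',
      Finset.mem_univ, if_true, Pi.zero_apply, Pi.sub_apply, sub_mul]
    linarith
  -- A square matrix has a nonzero left kernel vector only if it has a nonzero right one.
  obtain ⟨v, hv, hv0⟩ := Matrix.exists_mulVec_eq_zero_iff.2 (Matrix.exists_vecMul_eq_zero_iff.1 hd)
  exact hv (hM v hv0)

/-! ### Reaching the permutation without positive weak excedances -/

theorem rate_nonneg {q α β : ℝ} (hq : 0 ≤ q) (hα : 0 < α) (hβ : 0 < β) {N : ℕ}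
    (π σ : Equiv.Perm (Fin (N + 1))) : 0 ≤ rate q α β π σ := by
  unfold rate
  split_ifs <;> positivity

theorem rate_pos_of_hopsRight {q α β : ℝ} (hq : 0 ≤ q) (hα : 0 < α) (hβ : 0 < β) {N : ℕ}
    {π σ : Equiv.Perm (Fin (N + 1))} (h : HopsRight π σ) : 0 < rate q α β π σ := by
  unfold rate
  rw [if_pos h]
  split_ifs <;> positivity

theorem rate_pos_of_exitsRight {q α β : ℝ} (hq : 0 ≤ q) (hα : 0 < α) (hβ : 0 < β) {N : ℕ}
    {π σ : Equiv.Perm (Fin (N + 1))} (h : ExitsRight π σ) : 0 < rate q α β π σ := by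
  unfold rate
  rw [if_pos h]
  split_ifs <;> positivity

open Classical in
/-- The sum of the distances of the weak excedances to the right end. -/
noncomputable def wexcDist {n : ℕ} (π : Equiv.Perm (Fin n)) : ℕ :=
  ∑ k ∈ (Finset.range n).filter (wexc π), (n - k)

/-- Replacing `m` by `m + 1`, or dropping it, lowers the sum because `m < n`; losing further weak
excedances can only help. -/
theorem wexcDist_lt {n : ℕ} {π σ : Equiv.Perm (Fin n)} {m : ℕ} (hm : wexc π m)
    (h : ∀ k, wexc σ k → k = m + 1 ∨ (wexc π k ∧ k ≠ m)) : wexcDist σ < wexcDist π := by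
  classical
  have hmem : m ∈ (Finset.range n).filter (wexc π) := by simp [hm, hm.lt]
  have hsub : (Finset.range n).filter (wexc σ) ⊆
      insert (m + 1) (((Finset.range n).filter (wexc π)).erase m) := by
    intro k hk
    simp only [Finset.mem_filter, Finset.mem_range, Finset.mem_insert, Finset.mem_erase] at hk ⊢
    rcases h k hk.2 with h | h
    · exact Or.inl h
    · exact Or.inr ⟨h.2, hk.1, h.1⟩
  have h1 := Finset.sum_le_sum_of_subset (f := fun k => n - k) hsub
  have h2 : ∀ s : Finset ℕ, ∑ k ∈ insert (m + 1) s, (n - k) ≤ (n - (m + 1)) + ∑ k ∈ s, (n - k) := by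
    intro s
    by_cases hs : m + 1 ∈ s
    · rw [Finset.insert_eq_of_mem hs]; exact Nat.le_add_left _ _
    · rw [Finset.sum_insert hs]
  have h2 := h2 (((Finset.range n).filter (wexc π)).erase m)
  have h3 := Finset.add_sum_erase _ (fun k => n - k) hmem
  have := hm.lt
  unfold wexcDist
  omega

/-- Take the greatest positive weak excedance. If it is the last position it exits; otherwise the
next position is a non-excedance and one of the three forms of hopping right applies. -/
theorem exists_rate_pos {q α β : ℝ} (hq : 0 ≤ q) (hα : 0 < α) (hβ : 0 < β) {N : ℕ}
    (π : Equiv.Perm (Fin (N + 1))) (h : ∃ k, k ≠ 0 ∧ wexc π k) :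
    ∃ σ, 0 < rate q α β π σ ∧ wexcDist σ < wexcDist π := by
  classical
  have hne : ((Finset.range (N + 1)).filter fun k => k ≠ 0 ∧ wexc π k).Nonempty := by
    obtain ⟨k, h0, hk⟩ := h
    exact ⟨k, by simp [h0, hk, hk.lt]⟩
  obtain ⟨k, hk, hmax⟩ := Finset.exists_max_image _ id hne
  simp only [Finset.mem_filter, Finset.mem_range, id] at hk hmax
  obtain ⟨hkN, hk0, hk⟩ := hk
  cases N with
  | zero => omega
  | succ n =>
    obtain ⟨i, rfl⟩ : ∃ i : Fin (n + 2), (i : ℕ) = k := ⟨⟨k, hkN⟩, rfl⟩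
    have hi0 : i ≠ 0 := by rintro rfl; exact hk0 rfl
    have hki := (wexc_val π i).1 hk
    by_cases hil : i = Fin.last _
    · subst hil
      have hπ : π (Fin.last _) = Fin.last _ := Fin.last_le_iff.1 hki
      obtain ⟨ρ, hρ⟩ := exists_ins π (Fin.last _)
      rw [hπ] at hρ
      have hw : ¬ wexc ρ (Fin.last (n + 1)) := fun h => by simpa using h.lt
      obtain ⟨g, hg⟩ := exists_next ρ
      have hst : π = cycleState ρ (Fin.last _) := by rw [cycleState_of_not hw, hρ]
      refine ⟨cycleState ρ (g (Fin.last _)), rate_pos_of_exitsRight hq hα hβ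
        ((exitsRight_iff _ _).2 ⟨ρ, _, hg _, hst, rfl⟩), wexcDist_lt hk fun k hk' => Or.inr ?_⟩
      rw [hst]
      exact wexc_cycleState_of_last (hg _) k hk'
    · have hil' : (i : ℕ) ≠ n + 1 := fun h => hil (Fin.ext h)
      obtain ⟨i', hi'⟩ : ∃ i' : Fin (n + 2), (i' : ℕ) = i + 1 := ⟨⟨i + 1, by omega⟩, rfl⟩
      have hπ' : π i' < i' := by
        rw [← not_le, ← wexc_val, hi']
        intro h
        have := hmax (i + 1) ⟨h.lt, by omega, h⟩
        omega
      have hcycle : ∀ ρ, π = cycleState ρ i → ∃ σ, 0 < rate q α β π σ ∧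
          wexcDist σ < wexcDist π := by
        intro ρ hρ
        obtain ⟨g, hg⟩ := exists_next ρ
        have hs : CycleStep π (cycleState ρ (g i)) ρ i := ⟨_, hg _, hρ, rfl⟩
        refine ⟨cycleState ρ (g i), rate_pos_of_hopsRight hq hα hβ ?_,
          wexcDist_lt hk fun k => ((hs.hops hi0 hil).2 k).1⟩
        by_cases hw : wexc ρ i
        · exact Or.inr (Or.inr ((hopsRight₃_iff _ _).2 ⟨ρ, i, ⟨hi0, hil, hw⟩, hs⟩))
        · exact Or.inl ((hopsRight₁_iff _ _).2 ⟨ρ, i, ⟨hi0, hil, hw⟩, hs⟩)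
      rcases hki.lt_or_eq with h1 | h1
      · by_cases h2 : π i' = i
        · obtain ⟨j, rfl⟩ : ∃ j : Fin (n + 1), j.castSucc = i :=
            ⟨i.castPred hil, Fin.castSucc_castPred _ _⟩
          obtain rfl : i' = j.succ := Fin.ext (by simp [hi'])
          obtain ⟨ρ, hρ⟩ := exists_ins π j.succ
          rw [h2] at hρ
          refine hcycle ρ ?_
          rw [cycleState_castSucc, hρ]
          rw [← hρ, wexc_ins_descent] at hk
          rcases hk with hk | hk
          · exact hk.2
          · rw [Fin.val_castSucc] at hk; omega
        · have h3 : π i' < i := by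
            refine lt_of_le_of_ne ?_ h2
            rw [Fin.lt_def] at hπ'
            rw [Fin.le_def]; omega
          exact ⟨_, rate_pos_of_hopsRight hq hα hβ
            (Or.inr (Or.inl ⟨i, i', hi0, hi', h1, h3, rfl⟩)),
            wexcDist_lt hk fun k => ((hops_mul_swap hi' h1 h3).2 k).1⟩
      · obtain ⟨ρ, hρ⟩ := exists_ins π i
        rw [← h1] at hρ
        refine hcycle ρ ?_
        rw [cycleState_of_not, hρ]
        intro hw
        refine not_le.2 hπ' ((wexc_val π i').1 ?_)
        rw [← hρ, wexc_ins_fixed, hi']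
        exact Or.inr (Or.inr ⟨by omega, by simpa using hw⟩)

/-- Inductively, the value at `k + 1` is at most `k`, and all smaller values are already taken by
the positions before it. -/
theorem val_of_forall_not_wexc {N : ℕ} {π : Equiv.Perm (Fin (N + 1))}
    (h : ∀ k, k ≠ 0 → ¬ wexc π k) (i : Fin (N + 1)) :
    (π i : ℕ) = if (i : ℕ) = 0 then N else (i : ℕ) - 1 := by
  have key : ∀ k (i : Fin (N + 1)), (i : ℕ) = k + 1 → (π i : ℕ) = k := by
    intro k
    induction k using Nat.strong_induction_on with
    | _ k ih =>
      intro i hi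
      have h1 := h i (by omega)
      rw [wexc_val, not_le, Fin.lt_def] at h1
      by_contra hne
      have := i.isLt
      have h2 := ih (π i) (by omega) ⟨π i + 1, by omega⟩ rfl
      have h3 := congrArg Fin.val (π.injective (Fin.ext h2))
      simp only at h3
      omega
  split_ifs with hi
  · by_contra hne
    have := (π i).isLt
    have h2 := key (π i) ⟨π i + 1, by omega⟩ rfl
    have h3 := congrArg Fin.val (π.injective (Fin.ext h2))
    simp only at h3
    omega
  · exact key _ i (by omega)

theorem exists_reachable {q α β : ℝ} (hq : 0 ≤ q) (hα : 0 < α) (hβ : 0 < β) (N : ℕ) :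
    ∃ s : Equiv.Perm (Fin (N + 1)), ∀ π, π ≠ s →
      ∃ σ, 0 < rate q α β π σ ∧ wexcDist σ < wexcDist π := by
  by_cases h : ∃ s : Equiv.Perm (Fin (N + 1)), ∀ k, k ≠ 0 → ¬ wexc s k
  · obtain ⟨s, hs⟩ := h
    refine ⟨s, fun π hπ => exists_rate_pos hq hα hβ π ?_⟩
    by_contra! hc
    exact hπ (Equiv.ext fun i => Fin.ext
      ((val_of_forall_not_wexc hc i).trans (val_of_forall_not_wexc hs i).symm))
  · push Not at h
    -- If every permutation had a positive weak excedance, every state would have a decreasing step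
    -- and any `s` would serve; this avoids constructing the exceptional permutation.
    exact ⟨1, fun π _ => exists_rate_pos hq hα hβ π (h π)⟩

/-! ### The steady state -/

/-- A rate from `σ` to itself enters inflow and outflow alike and cancels, so stationarity is the
balance of the full sums of rates. -/
theorem sum_mul_prob (q α β : ℝ) {N : ℕ} (μ : Equiv.Perm (Fin (N + 1)) → ℝ)
    (σ : Equiv.Perm (Fin (N + 1))) :
    ∑ π, μ π * prob q α β π σ = μ σ +
      (∑ π, μ π * rate q α β π σ - ∑ π, μ σ * rate q α β σ π) / (N + 1) := by
  have hN : (N : ℝ) + 1 ≠ 0 := by positivity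
  rw [← Finset.add_sum_erase _ _ (Finset.mem_univ σ),
    ← Finset.add_sum_erase _ (fun π => μ π * rate q α β π σ) (Finset.mem_univ σ),
    ← Finset.add_sum_erase _ (fun π => μ σ * rate q α β σ π) (Finset.mem_univ σ), prob, if_pos rfl]
  have h : ∑ π ∈ Finset.univ.erase σ, μ π * prob q α β π σ =
      (∑ π ∈ Finset.univ.erase σ, μ π * rate q α β π σ) / (N + 1) := by
    rw [Finset.sum_div]
    refine Finset.sum_congr rfl fun π hπ => ?_
    rw [prob, if_neg (Finset.ne_of_mem_erase hπ).symm, mul_div_assoc]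
  rw [h, ← Finset.sum_div, ← Finset.mul_sum]
  field_simp
  ring

theorem stationary_iff (q α β : ℝ) {N : ℕ} (μ : Equiv.Perm (Fin (N + 1)) → ℝ)
    (σ : Equiv.Perm (Fin (N + 1))) :
    ∑ π, μ π * prob q α β π σ = μ σ ↔
      ∑ π, μ π * rate q α β π σ = ∑ π, μ σ * rate q α β σ π := by
  have hN : (N : ℝ) + 1 ≠ 0 := by positivity
  rw [sum_mul_prob, add_eq_left, div_eq_zero_iff, or_iff_left hN, sub_eq_zero]

theorem IsSteadyState.unique {q α β : ℝ} (hq : 0 ≤ q) (hα : 0 < α) (hβ : 0 < β) {N : ℕ}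
    {μ ν : Equiv.Perm (Fin (N + 1)) → ℝ} (hμ : IsSteadyState q α β μ)
    (hν : IsSteadyState q α β ν) : μ = ν := by
  obtain ⟨s, hs⟩ := exists_reachable hq hα hβ N
  exact eq_of_balance (rate_nonneg hq hα hβ) wexcDist s hs
    (fun σ => (stationary_iff q α β μ σ).1 (hμ.stationary σ))
    (fun σ => (stationary_iff q α β ν σ).1 (hν.stationary σ))
    (hμ.sum_eq_one.trans hν.sum_eq_one.symm)

theorem wt_nonneg {q α β : ℝ} (hq : 0 ≤ q) (hα : 0 < α) (hβ : 0 < β) {N : ℕ}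
    (π : Equiv.Perm (Fin (N + 1))) : 0 ≤ wt q α β π := by
  unfold wt
  positivity

theorem sum_wt_pos {q α β : ℝ} (hq : 0 ≤ q) (hα : 0 < α) (hβ : 0 < β) (N : ℕ) :
    0 < ∑ π : Equiv.Perm (Fin (N + 1)), wt q α β π := by
  refine Finset.sum_pos' (fun π _ => wt_nonneg hq hα hβ π) ⟨1, Finset.mem_univ _, ?_⟩
  have h : rk (1 : Equiv.Perm (Fin (N + 1))) = 0 := by
    rw [rk, Finset.card_eq_zero, Finset.filter_eq_empty_iff]
    rintro ⟨i, j⟩ - (h | h)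
    · exact absurd h.1 (not_lt.2 h.2.1)
    · exact absurd h.2.1 (not_lt.2 h.2.2.le)
  unfold wt
  rw [h, pow_zero]
  positivity

theorem isSteadyState_wt {q α β : ℝ} (hq : 0 ≤ q) (hα : 0 < α) (hβ : 0 < β) (N : ℕ) :
    IsSteadyState q α β fun π : Equiv.Perm (Fin (N + 1)) => wt q α β π / ∑ σ : Equiv.Perm (Fin (N + 1)), wt q α β σ where
  nonneg π := div_nonneg (wt_nonneg hq hα hβ π) (sum_wt_pos hq hα hβ N).le
  sum_eq_one := by rw [← Finset.sum_div, div_self (sum_wt_pos hq hα hβ N).ne']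
  stationary σ := by
    rw [stationary_iff]
    simp only [div_mul_eq_mul_div]
    rw [← Finset.sum_div, ← Finset.sum_div, sum_wt_mul_rate hα.ne' hβ.ne']

theorem IsSteadyState.eq_bar {q α β : ℝ} (hq : 0 ≤ q) (hα : 0 < α) (hβ : 0 < β) {N : ℕ}
    {μ ν : Equiv.Perm (Fin (N + 1)) → ℝ} (hμ : IsSteadyState q α β μ)
    (hν : IsSteadyState q β α ν) (π : Equiv.Perm (Fin (N + 1))) : μ π = ν (bar π) := by
  rw [hμ.unique hq hα hβ (isSteadyState_wt hq hα hβ N),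
    hν.unique hq hβ hα (isSteadyState_wt hq hβ hα N)]
  have h : ∑ σ : Equiv.Perm (Fin (N + 1)), wt q β α σ =
      ∑ σ : Equiv.Perm (Fin (N + 1)), wt q α β σ := by
    rw [← Equiv.sum_comp (Function.Involutive.toPerm bar bar_bar)]
    exact Finset.sum_congr rfl fun σ _ => wt_bar q α β σ
  simp only
  rw [wt_bar, h]

/-! ### Permutation tableaux with given row lengths -/

theorem mem_boxes {l : List ℕ} {c : ℕ × ℕ} : c ∈ boxes l ↔ c.2 < l.getD c.1 0 := by
  obtain ⟨i, j⟩ := c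
  simp only [boxes, Finset.mem_biUnion, Finset.mem_range, Finset.mem_image, Prod.mk.injEq]
  constructor
  · rintro ⟨i, _, j, hj, rfl, rfl⟩
    exact hj
  · intro h
    refine ⟨i, ?_, j, h, rfl, rfl⟩
    by_contra hi
    rw [List.getD_eq_default _ _ (not_lt.1 hi)] at h
    exact absurd h (Nat.not_lt_zero _)

/-- `T` is the set of ones of a permutation tableau with row lengths `r`. -/
structure Tableau (r : ℕ → ℕ) (T : Finset (ℕ × ℕ)) : Prop where
  lt : ∀ i j, (i, j) ∈ T → j < r i
  col : ∀ j < r 0, ∃ i, (i, j) ∈ T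
  zero : ∀ i j, j < r i → (i, j) ∉ T → ∀ i' < i, (i', j) ∈ T → ∀ j' < j, (i, j') ∉ T

/-- With default length `0`, rows beyond the list are empty, so bounds on row indices can be
dropped. -/
theorem mem_permTableaux {l : List ℕ} {T : Finset (ℕ × ℕ)} :
    T ∈ permTableaux l ↔ Tableau (fun i => l.getD i 0) T := by
  have hh : l.headD 0 = l.getD 0 0 := by cases l <;> rfl
  simp only [permTableaux, Finset.mem_filter, Finset.mem_powerset, IsPermTableau, hh]
  constructor
  · rintro ⟨h, -, h1, h2⟩
    refine ⟨fun i j hij => mem_boxes.1 (h hij), fun j hj => ?_,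
      fun i j hj hT i' hi' hT' j' hj' hT'' => ?_⟩
    · obtain ⟨i, -, hi⟩ := h1 j hj
      exact ⟨i, hi⟩
    · exact h2 (i, j) (mem_boxes.2 hj) hT ⟨⟨i', hi', hT'⟩, ⟨j', hj', hT''⟩⟩
  · intro h
    have hsub : T ⊆ boxes l := fun c hc => mem_boxes.2 (h.lt c.1 c.2 hc)
    refine ⟨hsub, hsub, fun j hj => ?_, ?_⟩
    · obtain ⟨i, hi⟩ := h.col j hj
      refine ⟨i, ?_, hi⟩
      by_contra hc
      have := h.lt i j hi
      simp only [List.getD_eq_default _ _ (not_lt.1 hc)] at this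
      exact absurd this (Nat.not_lt_zero _)
    · rintro ⟨i, j⟩ hc hT ⟨⟨i', hi', h1⟩, ⟨j', hj', h2⟩⟩
      exact h.zero i j (mem_boxes.1 hc) hT i' hi' h1 j' hj' h2

/-- Row `i` contains a zero that has a one above it. -/
def Restricted (r : ℕ → ℕ) (T : Finset (ℕ × ℕ)) (i : ℕ) : Prop :=
  ∃ j < r i, (i, j) ∉ T ∧ ∃ i' < i, (i', j) ∈ T

open Classical in
theorem uT_eq (l : List ℕ) (T : Finset (ℕ × ℕ)) :
    uT l T = ((Finset.range l.length).filter fun i =>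
      ¬ Restricted (fun i => l.getD i 0) T i).card - 1 := by
  unfold uT
  congr 2
  ext i
  rw [Finset.mem_filter, Finset.mem_filter]
  refine and_congr_right fun _ => not_congr ⟨?_, ?_⟩
  · rintro ⟨⟨i, j⟩, hc, rfl, h1, h2⟩
    exact ⟨j, mem_boxes.1 hc, h1, h2⟩
  · rintro ⟨j, hj, h1, h2⟩
    exact ⟨(i, j), mem_boxes.2 hj, rfl, h1, h2⟩

/-- The weight of a permutation tableau. -/
def wtT {K : Type*} [Field K] (q α β : K) (l : List ℕ) (T : Finset (ℕ × ℕ)) : K :=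
  q ^ rkT T * α ^ (-(fT T : ℤ)) * β ^ (-(uT l T : ℤ))

theorem F_eq {K : Type*} [Field K] (q α β : K) (l : List ℕ) :
    F q α β l = ∑ T ∈ permTableaux l, wtT q α β l T := rfl

/-! ### A hole at the first site, or a particle at the last site -/

/-- The last column is a single box in the first row, which must contain a one. Removing it changes
only the number of ones in the first row. -/
theorem F_cons_succ {K : Type*} [Field K] (q α β : K) (hα : α ≠ 0) (c : ℕ) (l : List ℕ)
    (hl : ∀ x ∈ l, x ≤ c) : F q α β ((c + 1) :: l) = α⁻¹ * F q α β (c :: l) := by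
  have hr : ∀ i, (c :: l).getD (i + 1) 0 ≤ c := by
    intro i
    rw [List.getD_cons_succ]
    by_cases hi : i < l.length
    · rw [List.getD_eq_getElem _ _ hi]
      exact hl _ (List.getElem_mem hi)
    · rw [List.getD_eq_default _ _ (not_lt.1 hi)]
      exact Nat.zero_le _
  have hrr : ∀ i, ((c + 1) :: l).getD i 0 = if i = 0 then c + 1 else (c :: l).getD i 0 := by
    rintro (_ | i) <;> simp
  have hr0 : (c :: l).getD 0 0 = c := rfl
  have hlen : ((c + 1) :: l).length = (c :: l).length := rfl
  generalize hL : (c :: l) = L at *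
  generalize hL' : ((c + 1) :: l) = L' at *
  have hnot : ∀ T, Tableau (fun i => L.getD i 0) T → ∀ i, (i, c) ∉ T := by
    rintro T hT (_ | i) h
    · have := hT.lt _ _ h
      simp only [hr0] at this
      omega
    · have := hT.lt _ _ h
      have := hr i
      omega
  rw [F_eq, F_eq, Finset.mul_sum]
  symm
  refine Finset.sum_nbij' (fun T => insert (0, c) T) (fun T => T.erase (0, c)) ?_ ?_ ?_ ?_ ?_
  · intro T hT
    rw [mem_permTableaux] at hT ⊢
    have hn := hnot T hT
    obtain ⟨h1, h2, h3⟩ := hT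
    simp only [hr0] at h2
    refine ⟨?_, ?_, ?_⟩
    · intro i j h
      have := h1 i j
      simp only [hrr]
      grind
    · intro j hj
      simp only [hrr, if_true] at hj
      rcases Nat.lt_succ_iff_lt_or_eq.1 hj with hj | rfl
      · obtain ⟨i, hi⟩ := h2 j hj
        exact ⟨i, Finset.mem_insert_of_mem hi⟩
      · exact ⟨0, Finset.mem_insert_self _ _⟩
    · intro i j hj hT i' hi' hT' j' hj' hT''
      have hi0 : i ≠ 0 := by omega
      have := h3 i j (by simpa only [hrr, hi0, if_false] using hj) (fun h => hT (Finset.mem_insert_of_mem h)) i' hi'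
      obtain ⟨k, rfl⟩ := Nat.exists_eq_succ_of_ne_zero hi0
      have := hr k
      simp only [hrr, hi0, if_false] at hj
      grind
  · intro T hT
    rw [mem_permTableaux] at hT ⊢
    obtain ⟨h1, h2, h3⟩ := hT
    simp only [hrr] at h1 h2 h3
    refine ⟨?_, ?_, ?_⟩
    · intro i j h
      have := h1 i j
      grind
    · intro j hj
      simp only [hr0] at hj
      obtain ⟨i, hi⟩ := h2 j (by simp; omega)
      exact ⟨i, Finset.mem_erase.2 ⟨by grind, hi⟩⟩
    · intro i j hj hT i' hi' hT' j' hj' hT''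
      have hi0 : i ≠ 0 := by omega
      have := h3 i j (by simpa [hi0] using hj) (by grind) i' hi' (by grind) j' hj'
      grind
  · intro T hT
    rw [mem_permTableaux] at hT
    exact Finset.erase_insert (hnot T hT 0)
  · intro T hT
    rw [mem_permTableaux] at hT
    obtain ⟨h1, h2, h3⟩ := hT
    simp only [hrr] at h1 h2
    refine Finset.insert_erase ?_
    obtain ⟨i, hi⟩ := h2 c (by simp)
    rcases i with _ | i
    · exact hi
    · have := h1 _ _ hi
      have := hr i
      simp at *
      omega
  · intro T hT
    rw [mem_permTableaux] at hT
    have hn := hnot T hT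
    have e1 : rkT (insert (0, c) T) = rkT T := by
      unfold rkT
      congr 1
      ext ⟨i, j⟩
      simp only [Finset.mem_filter, Finset.mem_insert, OneAbove]
      grind
    have e2 : fT (insert (0, c) T) = fT T + 1 := by
      unfold fT
      rw [Finset.filter_insert, if_pos rfl, Finset.card_insert_of_notMem]
      simp [hn]
    have e3 : uT L' (insert (0, c) T) = uT L T := by
      rw [uT_eq, uT_eq, hlen]
      congr 3
      ext i
      refine not_congr ⟨?_, ?_⟩
      · rintro ⟨j, hj, h1, i', hi', h2⟩
        have hi0 : i ≠ 0 := by omega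
        obtain ⟨k, rfl⟩ := Nat.exists_eq_succ_of_ne_zero hi0
        have := hr k
        simp only [hrr, hi0, if_false] at hj
        exact ⟨j, hj, by grind, i', hi', by grind⟩
      · rintro ⟨j, hj, h1, i', hi', h2⟩
        have hi0 : i ≠ 0 := by omega
        exact ⟨j, by simpa only [hrr, hi0, if_false] using hj, by grind, i', hi', by grind⟩
    unfold wtT
    rw [e1, e2, e3, Nat.cast_add, neg_add, zpow_add₀ hα, Nat.cast_one, zpow_neg_one]
    ring

/-- An empty last row leaves the fillings unchanged and adds one unrestricted row. -/
theorem F_append_zero {K : Type*} [Field K] (q α β : K) (hβ : β ≠ 0) (c : ℕ) (l : List ℕ) :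
    F q α β ((c :: l) ++ [0]) = β⁻¹ * F q α β (c :: l) := by
  classical
  have hr : (fun i => ((c :: l) ++ [0]).getD i 0) = fun i => (c :: l).getD i 0 := by
    funext i
    by_cases hi : i < (c :: l).length
    · exact List.getD_append _ _ _ _ hi
    · rw [List.getD_append_right _ _ _ _ (not_lt.1 hi), List.getD_eq_default _ _ (not_lt.1 hi)]
      cases i - (c :: l).length <;> rfl
  have hp : permTableaux ((c :: l) ++ [0]) = permTableaux (c :: l) := by
    ext T
    rw [mem_permTableaux, mem_permTableaux, hr]
  rw [F_eq, F_eq, hp, Finset.mul_sum]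
  refine Finset.sum_congr rfl fun T hT => ?_
  have e : uT ((c :: l) ++ [0]) T = uT (c :: l) T + 1 := by
    rw [uT_eq, uT_eq, hr, List.length_append, List.length_singleton, Finset.range_add_one,
      Finset.filter_insert, if_pos, Finset.card_insert_of_notMem (by simp), Nat.add_sub_cancel,
      Nat.sub_add_cancel]
    -- The first row is unrestricted, so the count is positive and the truncated subtraction of `1`
    -- is harmless.
    · refine Finset.card_pos.2 ⟨0, Finset.mem_filter.2 ⟨by simp, ?_⟩⟩
      rintro ⟨j, -, -, i, hi, -⟩
      exact absurd hi (Nat.not_lt_zero _)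
    · rintro ⟨j, hj, -⟩
      simp only [List.getD_eq_default _ _ le_rfl] at hj
      exact absurd hj (Nat.not_lt_zero _)
  unfold wtT
  rw [e, Nat.cast_add, neg_add, zpow_add₀ hβ, Nat.cast_one, zpow_neg_one]
  ring

/-! ### Inserting and deleting rows and columns -/

/-- Insert an empty column at `k`. -/
def addCol (k : ℕ) (T : Finset (ℕ × ℕ)) : Finset (ℕ × ℕ) :=
  T.image fun c => (c.1, if c.2 < k then c.2 else c.2 + 1)

/-- Delete the column `k`. -/
def delCol (k : ℕ) (T : Finset (ℕ × ℕ)) : Finset (ℕ × ℕ) :=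
  (T.filter fun c => c.2 ≠ k).image fun c => (c.1, if c.2 < k then c.2 else c.2 - 1)

/-- Insert an empty row at `k`. -/
def addRow (k : ℕ) (T : Finset (ℕ × ℕ)) : Finset (ℕ × ℕ) :=
  T.image fun c => (if c.1 < k then c.1 else c.1 + 1, c.2)

/-- Delete the row `k`. -/
def delRow (k : ℕ) (T : Finset (ℕ × ℕ)) : Finset (ℕ × ℕ) :=
  (T.filter fun c => c.1 ≠ k).image fun c => (if c.1 < k then c.1 else c.1 - 1, c.2)

theorem mem_addCol {k : ℕ} {T : Finset (ℕ × ℕ)} {i j : ℕ} :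
    (i, j) ∈ addCol k T ↔ j ≠ k ∧ (i, if j < k then j else j - 1) ∈ T := by
  simp only [addCol, Finset.mem_image, Prod.exists, Prod.mk.injEq]
  constructor
  · rintro ⟨a, b, h, rfl, rfl⟩
    refine ⟨by grind, ?_⟩
    convert h using 2
    grind
  · rintro ⟨h1, h2⟩
    exact ⟨_, _, h2, rfl, by grind⟩

theorem mem_delCol {k : ℕ} {T : Finset (ℕ × ℕ)} {i j : ℕ} :
    (i, j) ∈ delCol k T ↔ (i, if j < k then j else j + 1) ∈ T := by
  simp only [delCol, Finset.mem_image, Finset.mem_filter, Prod.exists, Prod.mk.injEq]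
  constructor
  · rintro ⟨a, b, ⟨h, h'⟩, rfl, rfl⟩
    convert h using 2
    grind
  · intro h
    exact ⟨_, _, ⟨h, by grind⟩, rfl, by grind⟩

theorem mem_addRow {k : ℕ} {T : Finset (ℕ × ℕ)} {i j : ℕ} :
    (i, j) ∈ addRow k T ↔ i ≠ k ∧ (if i < k then i else i - 1, j) ∈ T := by
  simp only [addRow, Finset.mem_image, Prod.exists, Prod.mk.injEq]
  constructor
  · rintro ⟨a, b, h, rfl, rfl⟩
    refine ⟨by grind, ?_⟩
    convert h using 2
    grind
  · rintro ⟨h1, h2⟩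
    exact ⟨_, _, h2, by grind, rfl⟩

theorem mem_delRow {k : ℕ} {T : Finset (ℕ × ℕ)} {i j : ℕ} :
    (i, j) ∈ delRow k T ↔ (if i < k then i else i + 1, j) ∈ T := by
  simp only [delRow, Finset.mem_image, Finset.mem_filter, Prod.exists, Prod.mk.injEq]
  constructor
  · rintro ⟨a, b, ⟨h, h'⟩, rfl, rfl⟩
    convert h using 2
    grind
  · intro h
    exact ⟨_, _, ⟨h, by grind⟩, by grind, rfl⟩

theorem card_addCol (k : ℕ) (T : Finset (ℕ × ℕ)) : (addCol k T).card = T.card := by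
  refine Finset.card_image_of_injective _ fun c d h => ?_
  simp only [Prod.mk.injEq] at h
  exact Prod.ext h.1 (by grind)

theorem card_addRow (k : ℕ) (T : Finset (ℕ × ℕ)) : (addRow k T).card = T.card := by
  refine Finset.card_image_of_injective _ fun c d h => ?_
  simp only [Prod.mk.injEq] at h
  exact Prod.ext (by grind) h.2

/-! ### The corner recursion -/

/-- `(i₀, j₀)` is a corner box, outside the first row, of the shape with row lengths `r`. -/
structure Corner (r : ℕ → ℕ) (i₀ j₀ : ℕ) : Prop where
  pos : 0 < i₀
  row : r i₀ = j₀ + 1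
  above : ∀ i < i₀, j₀ < r i
  below : ∀ i, i₀ < i → r i ≤ j₀

variable {r r' : ℕ → ℕ} {i₀ j₀ : ℕ} {T : Finset (ℕ × ℕ)}

theorem Corner.le_of_mem_col (hc : Corner r i₀ j₀) (hT : Tableau r T) {i : ℕ} (h : (i, j₀) ∈ T) :
    i ≤ i₀ := by
  by_contra hi
  have h1 := hT.lt _ _ h
  have h2 := hc.below i (not_le.1 hi)
  omega

theorem Corner.tableau_insert (hc : Corner r i₀ j₀) (hr : ∀ i, r' i = if i = i₀ then j₀ else r i)
    (hT : Tableau r' T) :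
    Tableau r (insert (i₀, j₀) T) ∧ (i₀, j₀) ∉ T ∧ ∃ i < i₀, (i, j₀) ∈ T := by
  obtain ⟨h0, h1, h2, h3⟩ := hc
  obtain ⟨t1, t2, t3⟩ := hT
  have hn : ∀ i, (i, j₀) ∈ T → i < i₀ := by
    intro i h
    have := t1 _ _ h
    have := h3 i
    rw [hr] at *
    grind
  have hr0 : r' 0 = r 0 := by rw [hr, if_neg h0.ne]
  refine ⟨⟨fun i j h => ?_, fun j hj => ?_, fun i j hj hT i' hi' hT' j' hj' hT'' => ?_⟩,
    fun h => lt_irrefl _ (hn _ h), ?_⟩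
  · have := t1 i j
    have := hr i
    grind
  · obtain ⟨i, hi⟩ := t2 j (hr0 ▸ hj)
    exact ⟨i, Finset.mem_insert_of_mem hi⟩
  · have := t3 i j
    have := hr i
    have := h3 i
    have := h3 i'
    have := t3 i j (by grind) (by grind) i' hi' (by grind) j' hj'
    grind
  · obtain ⟨i, hi⟩ := t2 j₀ (hr0 ▸ h2 0 h0)
    exact ⟨i, hn i hi, hi⟩

theorem Corner.tableau_erase (hc : Corner r i₀ j₀) (hr : ∀ i, r' i = if i = i₀ then j₀ else r i)
    (hT : Tableau r T) (ho : ∃ i < i₀, (i, j₀) ∈ T) :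
    Tableau r' (T.erase (i₀, j₀)) := by
  have hle := fun i => hc.le_of_mem_col (i := i) hT
  obtain ⟨h0, h1, h2, h3⟩ := hc
  obtain ⟨t1, t2, t3⟩ := hT
  refine ⟨fun i j h => ?_, fun j hj => ?_, fun i j hj hT i' hi' hT' j' hj' hT'' => ?_⟩
  · have := t1 i j
    have := hr i
    grind
  · rw [hr, if_neg h0.ne] at hj
    by_cases hjj : j = j₀
    · obtain ⟨i, hi, hi'⟩ := ho
      exact ⟨i, by grind⟩
    · obtain ⟨i, hi⟩ := t2 j hj
      exact ⟨i, by grind⟩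
  · have := hr i
    have := t3 i j (by grind) (by grind) i' hi' (by grind) j' hj'
    grind

theorem Corner.tableau_addCol (hc : Corner r i₀ j₀)
    (hr : ∀ i, r' i = if i ≤ i₀ then r i - 1 else r i) (hT : Tableau r' T) :
    Tableau r (insert (i₀, j₀) (addCol j₀ T)) := by
  obtain ⟨h0, h1, h2, h3⟩ := hc
  obtain ⟨t1, t2, t3⟩ := hT
  refine ⟨fun i j h => ?_, fun j hj => ?_, fun i j hj hT i' hi' hT' j' hj' hT'' => ?_⟩
  · simp only [Finset.mem_insert, Prod.mk.injEq, mem_addCol] at h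
    rcases h with h | ⟨h, h'⟩
    · rw [h.1, h.2, h1]
      omega
    · have := t1 _ _ h'
      have := hr i
      have := h2 i
      have := h3 i
      grind
  · by_cases hjj : j = j₀
    · exact ⟨i₀, by simp [hjj]⟩
    · have := h2 0 h0
      obtain ⟨i, hi⟩ := t2 (if j < j₀ then j else j - 1) (by rw [hr]; split_ifs <;> omega)
      exact ⟨i, Finset.mem_insert_of_mem (mem_addCol.2 ⟨hjj, hi⟩)⟩
  · simp only [Finset.mem_insert, Prod.mk.injEq, mem_addCol, not_or, not_and] at hT hT' hT''
    have := h3 i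
    have hjj : j ≠ j₀ := by grind
    have hjj' : j' ≠ j₀ := by grind
    have hr' := hr i
    refine t3 i (if j < j₀ then j else j - 1) ?_ (hT.2 hjj) i' hi' (by grind)
      (if j' < j₀ then j' else j' - 1) (by grind) (by grind)
    have := h2 i
    grind

theorem Corner.tableau_delCol (hc : Corner r i₀ j₀)
    (hr : ∀ i, r' i = if i ≤ i₀ then r i - 1 else r i) (hT : Tableau r T) :
    Tableau r' (delCol j₀ T) := by
  obtain ⟨h0, h1, h2, h3⟩ := hc
  obtain ⟨t1, t2, t3⟩ := hT
  refine ⟨fun i j h => ?_, fun j hj => ?_, fun i j hj hT i' hi' hT' j' hj' hT'' => ?_⟩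
  · rw [mem_delCol] at h
    have := t1 _ _ h
    have := h2 i
    have := h3 i
    have : i = i₀ → r i = j₀ + 1 := fun h => h ▸ h1
    rw [hr]
    split_ifs at * <;> omega
  · rw [hr, if_pos h0.le] at hj
    obtain ⟨i, hi⟩ := t2 (if j < j₀ then j else j + 1) (by split_ifs <;> omega)
    exact ⟨i, mem_delCol.2 hi⟩
  · rw [mem_delCol] at hT hT' hT''
    refine t3 i _ ?_ hT i' hi' hT' _ ?_ hT''
    · rw [hr] at hj
      have := h2 i
      have := h3 i
      have : i = i₀ → r i = j₀ + 1 := fun h => h ▸ h1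
      split_ifs at * <;> omega
    · split_ifs <;> omega

theorem Corner.tableau_addRow (hc : Corner r i₀ j₀)
    (hr : ∀ i, r' i = if i < i₀ then r i else r (i + 1)) (hT : Tableau r' T) :
    Tableau r (addRow i₀ T) ∧ ∃ i < i₀, (i, j₀) ∈ addRow i₀ T := by
  obtain ⟨h0, h1, h2, h3⟩ := hc
  obtain ⟨t1, t2, t3⟩ := hT
  have hr0 : r' 0 = r 0 := by rw [hr, if_pos h0]
  have hr1 : ∀ i, i ≠ i₀ → r' (if i < i₀ then i else i - 1) = r i := by
    intro i hi
    rw [hr]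
    split_ifs <;> first | rfl | (congr 1; omega)
  have hcol : ∀ j < r 0, ∃ i, (i, j) ∈ addRow i₀ T := by
    intro j hj
    obtain ⟨i, hi⟩ := t2 j (hr0 ▸ hj)
    refine ⟨if i < i₀ then i else i + 1, mem_addRow.2 ⟨by grind, ?_⟩⟩
    convert hi using 2
    grind
  refine ⟨⟨fun i j h => ?_, hcol, fun i j hj hT i' hi' hT' j' hj' hT'' => ?_⟩, ?_⟩
  · rw [mem_addRow] at h
    rw [← hr1 i h.1]
    exact t1 _ _ h.2
  · rw [mem_addRow] at hT hT' hT''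
    refine t3 _ j ?_ (fun h => hT ⟨hT''.1, h⟩) _ ?_ hT'.2 j' hj' hT''.2
    · rwa [hr1 i hT''.1]
    · have := hT'.1
      have := hT''.1
      split_ifs <;> omega
  · obtain ⟨i, hi⟩ := hcol j₀ (h2 0 h0)
    refine ⟨i, ?_, hi⟩
    have := mem_addRow.1 hi
    have h4 := t1 _ _ this.2
    rw [hr1 i this.1] at h4
    have := h3 i
    omega

theorem Corner.tableau_delRow (hc : Corner r i₀ j₀)
    (hr : ∀ i, r' i = if i < i₀ then r i else r (i + 1)) (hT : Tableau r T)
    (he : ∀ j, (i₀, j) ∉ T) : Tableau r' (delRow i₀ T) := by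
  obtain ⟨h0, h1, h2, h3⟩ := hc
  obtain ⟨t1, t2, t3⟩ := hT
  have hr1 : ∀ i, r' i = r (if i < i₀ then i else i + 1) := by
    intro i
    rw [hr]
    split_ifs <;> rfl
  refine ⟨fun i j h => ?_, fun j hj => ?_, fun i j hj hT i' hi' hT' j' hj' hT'' => ?_⟩
  · rw [mem_delRow] at h
    rw [hr1]
    exact t1 _ _ h
  · rw [hr, if_pos h0] at hj
    obtain ⟨i, hi⟩ := t2 j hj
    have hne : i ≠ i₀ := by rintro rfl; exact he j hi
    refine ⟨if i < i₀ then i else i - 1, mem_delRow.2 ?_⟩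
    convert hi using 2
    grind
  · rw [mem_delRow] at hT hT' hT''
    refine t3 _ j ?_ hT _ ?_ hT' j' hj' hT''
    · rwa [← hr1]
    · split_ifs <;> omega

/-- A zero in the corner box has a one above it, so that its row is empty. -/
theorem Corner.row_empty (hc : Corner r i₀ j₀) (hT : Tableau r T) (h : (i₀, j₀) ∉ T) (j : ℕ) :
    (i₀, j) ∉ T := by
  intro hj
  have hlt := hT.lt _ _ hj
  rw [hc.row] at hlt
  have hne : j ≠ j₀ := by rintro rfl; exact h hj
  obtain ⟨i, hi⟩ := hT.col j₀ (hc.above 0 hc.pos)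
  have hle := hc.le_of_mem_col hT hi
  have hii : i ≠ i₀ := by rintro rfl; exact h hi
  exact hT.zero i₀ j₀ (by rw [hc.row]; omega) h i (by omega) hi j (by omega) hj

/-! ### The three terms of the corner recursion -/

/-- A one in the corner with a one above it can be cut off with its box. Only the rank drops, since
a one never restricts its row and the corner lies below the first row. -/
theorem F_superfluous {K : Type*} [Field K] (q α β : K) {l l' : List ℕ} {i₀ j₀ : ℕ}
    (hc : Corner (fun i => l.getD i 0) i₀ j₀) (hlen : l'.length = l.length)
    (hr : ∀ i, l'.getD i 0 = if i = i₀ then j₀ else l.getD i 0) :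
    (∑ T ∈ (permTableaux l).filter fun T => (i₀, j₀) ∈ T ∧ ∃ i < i₀, (i, j₀) ∈ T,
      wtT q α β l T) = q * F q α β l' := by
  rw [F_eq, Finset.mul_sum]
  symm
  refine Finset.sum_nbij' (fun T => insert (i₀, j₀) T) (fun T => T.erase (i₀, j₀)) ?_ ?_ ?_ ?_ ?_
  · intro T hT
    rw [mem_permTableaux] at hT
    obtain ⟨h1, h2, i, hi, hi'⟩ := hc.tableau_insert hr hT
    rw [Finset.mem_filter, mem_permTableaux]
    exact ⟨h1, Finset.mem_insert_self _ _, i, hi, Finset.mem_insert_of_mem hi'⟩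
  · intro T hT
    rw [Finset.mem_filter, mem_permTableaux] at hT
    rw [mem_permTableaux]
    exact hc.tableau_erase hr hT.1 hT.2.2
  · intro T hT
    rw [mem_permTableaux] at hT
    exact Finset.erase_insert (hc.tableau_insert hr hT).2.1
  · intro T hT
    rw [Finset.mem_filter] at hT
    exact Finset.insert_erase hT.2.1
  · intro T hT
    rw [mem_permTableaux] at hT
    obtain ⟨h1, h2, i, hi, hi'⟩ := hc.tableau_insert hr hT
    have hle : ∀ i, (i, j₀) ∈ T → i ≤ i₀ := fun i h =>
      hc.le_of_mem_col h1 (Finset.mem_insert_of_mem h)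
    have e1 : rkT (insert (i₀, j₀) T) = rkT T + 1 := by
      unfold rkT
      rw [Finset.filter_insert, if_pos ⟨i, hi, Finset.mem_insert_of_mem hi'⟩,
        Finset.card_insert_of_notMem (by simp [h2])]
      congr 2
      ext ⟨a, b⟩
      simp only [Finset.mem_filter, Finset.mem_insert, OneAbove]
      grind
    have e2 : fT (insert (i₀, j₀) T) = fT T := by
      unfold fT
      rw [Finset.filter_insert, if_neg hc.pos.ne']
    have e3 : uT l (insert (i₀, j₀) T) = uT l' T := by
      rw [uT_eq, uT_eq, hlen]
      congr 3
      ext a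
      have hb := hc.below a
      have hr0 := hc.row
      have hra := hr a
      simp only [Restricted] at *
      refine not_congr ⟨?_, ?_⟩
      · rintro ⟨j, hj, h3, i', hi', h4⟩
        exact ⟨j, by grind, by grind, i', hi', by grind⟩
      · rintro ⟨j, hj, h3, i', hi', h4⟩
        exact ⟨j, by grind, by grind, i', hi', by grind⟩
    unfold wtT
    rw [e1, e2, e3]
    ring

/-- If the corner holds the only one of its column, the whole column can be deleted: its zeros have
no one above them and restrict no row, and its one is topmost and not in the first row. -/
theorem F_single {K : Type*} [Field K] (q α β : K) {l l' : List ℕ} {i₀ j₀ : ℕ}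
    (hc : Corner (fun i => l.getD i 0) i₀ j₀) (hlen : l'.length = l.length)
    (hr : ∀ i, l'.getD i 0 = if i ≤ i₀ then l.getD i 0 - 1 else l.getD i 0) :
    (∑ T ∈ (permTableaux l).filter fun T => (i₀, j₀) ∈ T ∧ ¬ ∃ i < i₀, (i, j₀) ∈ T,
      wtT q α β l T) = F q α β l' := by
  rw [F_eq]
  symm
  refine Finset.sum_nbij' (fun T => insert (i₀, j₀) (addCol j₀ T)) (fun T => delCol j₀ T)
    ?_ ?_ ?_ ?_ ?_
  · intro T hT
    rw [mem_permTableaux] at hT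
    rw [Finset.mem_filter, mem_permTableaux]
    refine ⟨hc.tableau_addCol hr hT, Finset.mem_insert_self _ _, ?_⟩
    rintro ⟨i, hi, h⟩
    rcases Finset.mem_insert.1 h with h | h
    · rw [Prod.mk.injEq] at h; omega
    · exact (mem_addCol.1 h).1 rfl
  · intro T hT
    rw [Finset.mem_filter, mem_permTableaux] at hT
    rw [mem_permTableaux]
    exact hc.tableau_delCol hr hT.1
  · intro T hT
    ext ⟨i, j⟩
    simp only [mem_delCol, Finset.mem_insert, mem_addCol, Prod.mk.injEq]
    grind
  · intro T hT
    rw [Finset.mem_filter, mem_permTableaux] at hT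
    have hle := fun i => hc.le_of_mem_col hT.1 (i := i)
    ext ⟨i, j⟩
    simp only [mem_delCol, Finset.mem_insert, mem_addCol, Prod.mk.injEq]
    grind
  · intro T hT
    rw [mem_permTableaux] at hT
    have hT' := hc.tableau_addCol hr hT
    have hle := fun i => hc.le_of_mem_col hT' (i := i)
    have e1 : rkT (insert (i₀, j₀) (addCol j₀ T)) = rkT T := by
      unfold rkT
      rw [← card_addCol j₀ (T.filter _)]
      congr 1
      ext ⟨a, b⟩
      simp only [Finset.mem_filter, Finset.mem_insert, OneAbove, mem_addCol, Prod.mk.injEq]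
      grind
    have e2 : fT (insert (i₀, j₀) (addCol j₀ T)) = fT T := by
      unfold fT
      rw [← card_addCol j₀ (T.filter _), Finset.filter_insert, if_neg hc.pos.ne']
      congr 1
      ext ⟨a, b⟩
      simp only [Finset.mem_filter, mem_addCol]
      grind
    have e3 : uT l (insert (i₀, j₀) (addCol j₀ T)) = uT l' T := by
      rw [uT_eq, uT_eq, hlen]
      congr 3
      ext a
      have hb := hc.below a
      have ha := hc.above a
      have hr0 := hc.row
      have hra := hr a
      simp only [Restricted, Finset.mem_insert, mem_addCol, Prod.mk.injEq] at *
      refine not_congr ⟨?_, ?_⟩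
      · rintro ⟨j, hj, h3, i', hi', h4⟩
        have hjj : j ≠ j₀ := by grind
        exact ⟨if j < j₀ then j else j - 1, by grind, by grind, i', hi', by grind⟩
      · rintro ⟨j, hj, h3, i', hi', h4⟩
        exact ⟨if j < j₀ then j else j + 1, by grind, by grind, i', hi', by grind⟩
    unfold wtT
    rw [e1, e2, e3]

/-- A zero in the corner has a one above it, so its row is empty and restricted. Deleting that row
changes no statistic. -/
theorem F_empty_row {K : Type*} [Field K] (q α β : K) {l l' : List ℕ} {i₀ j₀ : ℕ}
    (hc : Corner (fun i => l.getD i 0) i₀ j₀) (hlen : l.length = l'.length + 1)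
    (hr : ∀ i, l'.getD i 0 = if i < i₀ then l.getD i 0 else l.getD (i + 1) 0) :
    (∑ T ∈ (permTableaux l).filter fun T => (i₀, j₀) ∉ T, wtT q α β l T) = F q α β l' := by
  classical
  rw [F_eq]
  symm
  refine Finset.sum_nbij' (fun T => addRow i₀ T) (fun T => delRow i₀ T) ?_ ?_ ?_ ?_ ?_
  · intro T hT
    rw [mem_permTableaux] at hT
    rw [Finset.mem_filter, mem_permTableaux]
    exact ⟨(hc.tableau_addRow hr hT).1, fun h => (mem_addRow.1 h).1 rfl⟩
  · intro T hT
    rw [Finset.mem_filter, mem_permTableaux] at hT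
    rw [mem_permTableaux]
    exact hc.tableau_delRow hr hT.1 (hc.row_empty hT.1 hT.2)
  · intro T hT
    ext ⟨i, j⟩
    simp only [mem_delRow, mem_addRow]
    grind
  · intro T hT
    rw [Finset.mem_filter, mem_permTableaux] at hT
    have he := hc.row_empty hT.1 hT.2
    ext ⟨i, j⟩
    simp only [mem_delRow, mem_addRow]
    grind
  · intro T hT
    rw [mem_permTableaux] at hT
    obtain ⟨hT', i₁, hi₁, hi₁'⟩ := hc.tableau_addRow hr hT
    have e1 : rkT (addRow i₀ T) = rkT T := by
      unfold rkT
      rw [← card_addRow i₀ (T.filter _)]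
      congr 1
      ext ⟨a, b⟩
      simp only [Finset.mem_filter, OneAbove, mem_addRow, and_assoc]
      refine and_congr_right fun h1 => and_congr_right fun h2 => ⟨?_, ?_⟩
      · rintro ⟨i, hi, h3, h4⟩
        exact ⟨_, by grind, h4⟩
      · rintro ⟨i, hi, h3⟩
        refine ⟨if i < i₀ then i else i + 1, by grind, by grind, ?_⟩
        convert h3 using 2
        grind
    have e2 : fT (addRow i₀ T) = fT T := by
      have := hc.pos
      unfold fT
      rw [← card_addRow i₀ (T.filter _)]
      congr 1
      ext ⟨a, b⟩
      simp only [Finset.mem_filter, mem_addRow]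
      grind
    have e3 : uT l (addRow i₀ T) = uT l' T := by
      rw [uT_eq, uT_eq, hlen]
      congr 1
      symm
      have hb := hc.row
      have hb' := hc.below
      have hres : ∀ a, Restricted (fun i => l'.getD i 0) T a ↔
          Restricted (fun i => l.getD i 0) (addRow i₀ T) (if a < i₀ then a else a + 1) := by
        intro a
        have hra : l'.getD a 0 = l.getD (if a < i₀ then a else a + 1) 0 := by
          rw [hr]; split_ifs <;> rfl
        simp only [Restricted, mem_addRow]
        rw [hra]
        refine exists_congr fun j => and_congr_right fun hj => and_congr ?_ ⟨?_, ?_⟩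
        · grind
        · rintro ⟨i, hi, h3⟩
          refine ⟨if i < i₀ then i else i + 1, by grind, by grind, ?_⟩
          convert h3 using 2
          grind
        · rintro ⟨i, hi, h3, h4⟩
          exact ⟨_, by grind, h4⟩
      have hi₀ : Restricted (fun i => l.getD i 0) (addRow i₀ T) i₀ :=
        ⟨j₀, by simp only; omega, fun h => (mem_addRow.1 h).1 rfl, i₁, hi₁, hi₁'⟩
      have hlt : i₀ < l'.length + 1 := by
        rw [← hlen]
        by_contra h
        rw [List.getD_eq_default _ _ (not_lt.1 h)] at hb
        omega
      refine Finset.card_nbij' (fun a => if a < i₀ then a else a + 1)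
        (fun a => if a < i₀ then a else a - 1) ?_ ?_ ?_ ?_
      · intro a ha
        simp only [Finset.coe_filter, Finset.mem_range, Set.mem_ofPred_eq] at ha ⊢
        rw [← hres]
        exact ⟨by grind, ha.2⟩
      · intro a ha
        simp only [Finset.coe_filter, Finset.mem_range, Set.mem_ofPred_eq] at ha ⊢
        have hne : a ≠ i₀ := by rintro rfl; exact ha.2 hi₀
        rw [hres]
        refine ⟨by grind, ?_⟩
        convert ha.2 using 2
        grind
      · intro a ha
        grind
      · intro a ha
        simp only [Finset.coe_filter, Finset.mem_range, Set.mem_ofPred_eq] at ha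
        have hne : a ≠ i₀ := by rintro rfl; exact ha.2 hi₀
        grind
    unfold wtT
    rw [e1, e2, e3]

/-- The recursion of the weight generating function at a corner of the shape. -/
theorem F_corner {K : Type*} [Field K] (q α β : K) {l l₁ l₂ l₃ : List ℕ} {i₀ j₀ : ℕ}
    (hc : Corner (fun i => l.getD i 0) i₀ j₀) (hlen₁ : l₁.length = l.length)
    (hr₁ : ∀ i, l₁.getD i 0 = if i = i₀ then j₀ else l.getD i 0) (hlen₂ : l₂.length = l.length)
    (hr₂ : ∀ i, l₂.getD i 0 = if i ≤ i₀ then l.getD i 0 - 1 else l.getD i 0)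
    (hlen₃ : l.length = l₃.length + 1)
    (hr₃ : ∀ i, l₃.getD i 0 = if i < i₀ then l.getD i 0 else l.getD (i + 1) 0) :
    F q α β l = q * F q α β l₁ + F q α β l₂ + F q α β l₃ := by
  rw [← F_superfluous q α β hc hlen₁ hr₁, ← F_single q α β hc hlen₂ hr₂,
    ← F_empty_row q α β hc hlen₃ hr₃, F_eq,
    ← Finset.sum_filter_add_sum_filter_not (permTableaux l) fun T => (i₀, j₀) ∈ T]
  congr 1
  rw [← Finset.sum_filter_add_sum_filter_not ((permTableaux l).filter fun T => (i₀, j₀) ∈ T)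
    fun T => ∃ i < i₀, (i, j₀) ∈ T, Finset.filter_filter, Finset.filter_filter]

/-! ### The recursion on lattice paths -/

theorem pathPartition_append (a b : List Bool) :
    pathPartition (a ++ b) = (pathPartition a).map (· + b.count false) ++ pathPartition b := by
  induction a with
  | nil => rfl
  | cons c a ih => cases c <;> simp [pathPartition, ih]

theorem le_of_mem_pathPartition {w : List Bool} {x : ℕ} (h : x ∈ pathPartition w) :
    x ≤ w.count false := by
  induction w with
  | nil => simp [pathPartition] at h
  | cons c w ih =>
    cases c
    · have := ih h
      simp
      omega
    · rw [pathPartition, List.mem_cons] at h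
      rw [List.count_cons_of_ne (by simp)]
      exact h.elim (fun h => h.le) ih

theorem getD_map_add_append (k : ℕ) (A B : List ℕ) (i : ℕ) :
    (A.map (· + k) ++ B).getD i 0 =
      if i < A.length then A.getD i 0 + k else B.getD (i - A.length) 0 := by
  split_ifs with h
  · rw [List.getD_append _ _ _ _ (by simpa using h), List.getD_eq_getElem _ _ (by simpa using h),
      List.getD_eq_getElem _ _ h, List.getElem_map]
  · rw [List.getD_append_right _ _ _ _ (by simpa using h), List.length_map]

/-- The weight generating function of the shape of a lattice path with an initial step south. -/
def pathWeight {K : Type*} [Field K] (q α β : K) (w : List Bool) : K :=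
  F q α β (pathPartition (true :: w))

theorem pathWeight_nil {K : Type*} [Field K] (q α β : K) : pathWeight q α β [] = 1 := by
  have h : permTableaux (pathPartition [true]) = {∅} := by
    ext T
    rw [mem_permTableaux, Finset.mem_singleton]
    have h0 : ∀ i, (pathPartition [true]).getD i 0 = 0 := by
      rintro (_ | _ | i) <;> rfl
    simp only [h0]
    constructor
    · intro hT
      exact Finset.eq_empty_of_forall_notMem fun c hc => absurd (hT.lt _ _ hc) (Nat.not_lt_zero _)
    · rintro rfl
      exact ⟨by simp, by simp, by simp⟩
  have hu : uT (pathPartition [true]) ∅ = 0 := by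
    have := Finset.card_filter_le (Finset.range (pathPartition [true]).length) fun i =>
      ¬ ∃ c ∈ boxes (pathPartition [true]), c.1 = i ∧ c ∉ (∅ : Finset (ℕ × ℕ)) ∧ OneAbove ∅ c
    rw [Finset.card_range] at this
    exact Nat.sub_eq_zero_of_le this
  rw [pathWeight, F_eq, h, Finset.sum_singleton, wtT, hu]
  simp [rkT, fT]

theorem pathWeight_false_cons {K : Type*} [Field K] (q α β : K) (hα : α ≠ 0) (w : List Bool) :
    pathWeight q α β (false :: w) = α⁻¹ * pathWeight q α β w := by
  rw [pathWeight, pathWeight]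
  simp only [pathPartition, List.count_cons_self]
  exact F_cons_succ q α β hα _ _ fun x hx => le_of_mem_pathPartition hx

theorem pathWeight_append_true {K : Type*} [Field K] (q α β : K) (hβ : β ≠ 0) (w : List Bool) :
    pathWeight q α β (w ++ [true]) = β⁻¹ * pathWeight q α β w := by
  rw [pathWeight, pathWeight, ← List.cons_append, pathPartition_append]
  have h1 : [true].count false = 0 := rfl
  have h2 : pathPartition [true] = [0] := rfl
  simp only [h1, h2, add_zero, List.map_id']
  exact F_append_zero q α β hβ _ _

/-- A step south followed by a step west bounds a corner box. Exchanging the two steps removes the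
box, omitting the west step deletes its column, and omitting the south step deletes its row. -/
theorem pathWeight_corner {K : Type*} [Field K] (q α β : K) (a b : List Bool) :
    pathWeight q α β (a ++ true :: false :: b) = q * pathWeight q α β (a ++ false :: true :: b) +
      pathWeight q α β (a ++ true :: b) + pathWeight q α β (a ++ false :: b) := by
  simp only [pathWeight]
  rw [← List.cons_append, ← List.cons_append, ← List.cons_append, ← List.cons_append,
    pathPartition_append, pathPartition_append, pathPartition_append, pathPartition_append]
  have hlen : 0 < (pathPartition (true :: a)).length := by simp [pathPartition]
  have hB : ∀ i, (pathPartition b).getD i 0 ≤ b.count false := by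
    intro i
    by_cases hi : i < (pathPartition b).length
    · rw [List.getD_eq_getElem _ _ hi]
      exact le_of_mem_pathPartition (List.getElem_mem hi)
    · rw [List.getD_eq_default _ _ (not_lt.1 hi)]
      exact Nat.zero_le _
  generalize pathPartition (true :: a) = A at *
  simp only [pathPartition, List.count_cons_self, List.count_cons_of_ne (show true ≠ false by simp)]
  generalize pathPartition b = B at *
  generalize b.count false = k at *
  have hcons : ∀ (x i : ℕ), (x :: B).getD i 0 = if i = 0 then x else B.getD (i - 1) 0 := by
    rintro x (_ | i) <;> simp
  -- The corner row follows the rows of the initial segment, of which there is at least one by the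
  -- initial step south; its last box lies in column `k`, the number of west steps in `b`.
  refine F_corner q α β (i₀ := A.length) (j₀ := k) ⟨hlen, ?_, fun i hi => ?_, fun i hi => ?_⟩
    (by simp) (fun i => ?_) (by simp) (fun i => ?_) (by simp; omega) (fun i => ?_)
  · simp only [getD_map_add_append, hcons]
    simp
  · simp only [getD_map_add_append, if_pos hi]
    omega
  · simp only [getD_map_add_append, hcons, if_neg hi.not_gt, if_neg (Nat.sub_ne_zero_of_lt hi)]
    exact hB _
  · simp only [getD_map_add_append, hcons]
    split_ifs <;> omega
  · simp only [getD_map_add_append, hcons]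
    split_ifs <;> omega
  · simp only [getD_map_add_append, hcons]
    split_ifs <;> first | rfl | omega | (congr 1; omega)

/-- The number of pairs of a step south and a later step. -/
def southRank : List Bool → ℕ
  | [] => 0
  | c :: w => (if c then w.length else 0) + southRank w

theorem southRank_corner (a b : List Bool) :
    southRank (a ++ true :: false :: b) = southRank (a ++ false :: true :: b) + 1 := by
  induction a with
  | nil => simp [southRank]; omega
  | cons c a ih => simp [southRank, ih]; omega

theorem exists_corner {w : List Bool} (h : false ∈ w) :
    ∃ a b, true :: w = a ++ true :: false :: b := by
  induction w with
  | nil => simp at h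
  | cons c w ih =>
    cases c
    · exact ⟨[], w, rfl⟩
    · obtain ⟨a, b, hab⟩ := ih (by simpa using h)
      exact ⟨true :: a, b, by rw [hab]; rfl⟩

/-- Reversal with complementation exchanges the two boundary rules and maps a corner to a corner,
swapping the last two terms of the recursion. A word that neither starts with a hole nor ends with a
particle contains a corner; resolving it shortens the word or lowers `southRank` at equal length. -/
theorem pathWeight_reverse_map_not {K : Type*} [Field K] (q α β : K) (hα : α ≠ 0) (hβ : β ≠ 0)
    (w : List Bool) : pathWeight q α β w = pathWeight q β α (w.map not).reverse := by
  induction hn : w.length using Nat.strong_induction_on generalizing w with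
  | _ n ihn =>
    induction hm : southRank w using Nat.strong_induction_on generalizing w with
    | _ m ihm =>
      rcases w with _ | ⟨_ | _, w⟩
      · simp [pathWeight_nil]
      · rw [pathWeight_false_cons _ _ _ hα, ihn w.length (by simp [← hn]) w rfl]
        simp [pathWeight_append_true _ _ _ hα]
      · obtain ⟨v, c, hv⟩ := List.eq_nil_or_concat (true :: w) |>.resolve_left (by simp)
        rw [List.concat_eq_append] at hv
        cases c
        · have hf : false ∈ true :: w := by rw [hv]; simp
          obtain ⟨a, b, hab⟩ := exists_corner (w := w) (by simpa using hf)
          rw [hab] at hn hm ⊢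
          rw [southRank_corner] at hm
          rw [pathWeight_corner, ihm _ (by omega) (a ++ false :: true :: b) (by simpa using hn) rfl,
            ihn _ (by simp at hn ⊢; omega) (a ++ true :: b) rfl,
            ihn _ (by simp at hn ⊢; omega) (a ++ false :: b) rfl]
          have h := pathWeight_corner q β α (b.map not).reverse (a.map not).reverse
          simp only [List.map_append, List.map_cons, List.reverse_append, List.reverse_cons,
            List.append_assoc, List.cons_append, List.nil_append, Bool.not_true,
            Bool.not_false] at h ⊢
          rw [h]
          ring
        · rw [hv] at hn ⊢
          rw [pathWeight_append_true _ _ _ hβ, ihn v.length (by simp [← hn]) v rfl]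
          simp [pathWeight_false_cons _ _ _ hβ]

theorem ofFn_barState {N : ℕ} (τ : Fin N → Bool) :
    List.ofFn (barState τ) = ((List.ofFn τ).map not).reverse := by
  refine List.ext_getElem (by simp) fun i h1 h2 => ?_
  simp only [barState, List.getElem_ofFn, List.getElem_reverse, List.getElem_map, List.length_map,
    List.length_ofFn]
  congr 2
  apply Fin.ext
  rw [Fin.val_rev]
  simp only
  omega

theorem F_shape_barState {K : Type*} [Field K] (q α β : K) (hα : α ≠ 0) (hβ : β ≠ 0) {N : ℕ}
    (τ : Fin N → Bool) : F q α β (shape τ) = F q β α (shape (barState τ)) := by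
  have := pathWeight_reverse_map_not q α β hα hβ (List.ofFn τ)
  rwa [← ofFn_barState] at this

end PTChain

theorem corollary7p3 (K : Type*) [Field K] (N : ℕ) :
    -- symmetry of the weight
    (∀ q α β : K, α ≠ 0 → β ≠ 0 →
      ∀ π : Equiv.Perm (Fin (N + 1)),
        PTChain.wt q α β π = PTChain.wt q β α (PTChain.bar π)) ∧
    -- symmetry of the steady state probabilities
    (∀ q α β : ℝ, 0 ≤ q → 0 < α → 0 < β →
      (∃! μ : Equiv.Perm (Fin (N + 1)) → ℝ, PTChain.IsSteadyState q α β μ) ∧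
      ∀ μ ν : Equiv.Perm (Fin (N + 1)) → ℝ,
        PTChain.IsSteadyState q α β μ → PTChain.IsSteadyState q β α ν →
          ∀ π, μ π = ν (PTChain.bar π)) ∧
    -- symmetry of the weight generating functions of permutation tableaux
    (∀ q α β : K, α ≠ 0 → β ≠ 0 →
      ∀ τ : Fin N → Bool,
        PTChain.F q α β (PTChain.shape τ) =
          PTChain.F q β α (PTChain.shape (PTChain.barState τ))) :=
  ⟨fun q α β _ _ π => (PTChain.wt_bar q α β π).symm,
    fun _ _ _ hq hα hβ => ⟨⟨_, PTChain.isSteadyState_wt hq hα hβ N,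
      fun _ hμ => hμ.unique hq hα hβ (PTChain.isSteadyState_wt hq hα hβ N)⟩,
      fun _ _ hμ hν π => hμ.eq_bar hq hα hβ hν π⟩,
    fun q α β hα hβ τ => PTChain.F_shape_barState q α β hα hβ τ⟩
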